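/- Let $N,m\ge 1$, $m_1,\dots,m_N\ge 1$ be integers, let $D^{(t)}\in\mathbb R^{m\times m_t}$ be arbitrary and let $a^{(t)}\in\mathbb R^{m_t}$ satisfy $a^{(t)}\ge 0$, $\sum_j a^{(t)}_j=1$ ($t=1,\dots,N$). Let $e_p$ be the all-ones vector in $\mathbb R^p$, $\Delta_m=\{w\in\mathbb R^m: w\ge0,\ e_m^\top w=1\}$, $\delta^*_{\Delta_m}$ the conjugate (support function) of its indicator function, and $\delta_+^t$ the indicator function ($0$ or $+\infty$) of the entrywise nonnegative matrices in $\mathbb R^{m\times m_t}$. For $u,\lambda, y^{(t)}\in\mathbb R^m$, $z^{(t)}\in\mathbb R^{m_t}$, $V^{(t)},\Lambda^{(t)}\in\mathbb R^{m\times m_t}$ put $$r_0=\sum_{t}y^{(t)}-u,\qquad R^{(t)}=V^{(t)}-D^{(t)}-y^{(t)}e_{m_t}^\top-e_m(z^{(t)})^\top ,$$ and for $\beta>0$ consider the augmented Lagrangian $$\mathcal L_\beta(u,V,y,z;\lambda,\Lambda)=\delta^*_{\Delta_m}(u)+\sum_t\delta^t_+(V^{(t)})+\sum_t\langle z^{(t)},a^{(t)}\rangle+\langle\lambda,r_0\rangle+\sum_t\langle\Lambda^{(t)},R^{(t)}\rangle+\tfrac\beta2\|r_0\|^2+\tfrac\beta2\sum_t\|R^{(t)}\|_F^2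 .$$ Let $\beta>0$ and $\tau\in\bigl(0,\tfrac{1+\sqrt5}2\bigr)$. A sequence $\mathcal W^k=(u^k,V^k,y^k,z^k,\lambda^k,\Lambda^k)$, $k\ge0$, is generated by the sGS-ADMM if $V^{(t),0}\ge0$ for all $t$ (the starting point being otherwise arbitrary) and for every $k\ge 0$: 1. $(u^{k+1},V^{k+1})$ minimizes $\mathcal L_\beta(u,V,y^k,z^k;\lambda^k,\Lambda^k)$ over $(u,V)$; 2. for a minimizer $\tilde z^{k+1}$ of $\mathcal L_\beta(u^{k+1},V^{k+1},y^k,z;\lambda^k,\Lambda^k)$ over $z$, the point $y^{k+1}$ minimizes $\mathcal L_\beta(u^{k+1},V^{k+1},y,\tilde z^{k+1};\lambda^k,\Lambda^k)$ over $y$, and $z^{k+1}$ minimizes $\mathcal L_\beta(u^{k+1},V^{k+1},y^{k+1},z;\lambda^k,\Lambda^k)$ over $z$; 3. $\lambda^{k+1}=\lambda^k+\tau\beta\, r_0^{k+1}$ and $\Lambda^{(t),k+1}=\Lambda^{(t),k}+\tau\beta R^{(t),k+1}$, where $r_0^{k+1},R^{(t),k+1}$ are the residuals at $(u^{k+1},V^{k+1},y^{k+1},z^{k+1})$.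 Let $\Omega$ be the set of all $(u,V,y,z,\lambda,\Lambda)$ satisfying the KKT system: $0\in\partial\delta^*_{\Delta_m}(u)-\lambda$; $0\in\partial\delta^t_+(V^{(t)})+\Lambda^{(t)}$, $\Lambda^{(t)}e_{m_t}=\lambda$, $(\Lambda^{(t)})^\top e_m=a^{(t)}$ and $R^{(t)}=0$ for all $t$; $r_0=0$. Let $A,B_1,B_2$ be the matrices with $A[u;v]=[-u;v]$, $B_1y=[\sum_ty^{(t)};-\mathrm{vec}(y^{(1)}e_{m_1}^\top);\dots;-\mathrm{vec}(y^{(N)}e_{m_N}^\top)]$, $B_2z=[0;-\mathrm{vec}(e_m(z^{(1)})^\top);\dots;-\mathrm{vec}(e_m(z^{(N)})^\top)]$, where $v=[\mathrm{vec}(V^{(1)});\dots;\mathrm{vec}(V^{(N)})]$; let $B=[B_1\ B_2]$ and $$C=\begin{bmatrix}B_1^\top B_2(B_2^\top B_2)^{-1}B_2^\top B_1&0\\0&0\end{bmatrix},\qquad s_\tau=\frac{5-\tau-3\min\{\tau,\tau^{-1}\}}4,$$ $$M=\begin{bmatrix}0&&\\&\beta C+\beta B^\top B&\\&&(\tau\beta)^{-1}I\end{bmatrix}+s_\tau\beta\begin{bmatrix}A^\top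 A&A^\top B&0\\B^\top A&B^\top B&0\\0&0&0\end{bmatrix}$$ in the block order $([u;v],[y;z],[\lambda;\mathrm{vec}\,\Lambda])$. Write $\|x\|_T=\sqrt{\langle x,Tx\rangle}$ and $\mathrm{dist}_M(\mathcal W,\Omega)=\inf_{\mathcal W'\in\Omega}\|\mathrm{vec}(\mathcal W)-\mathrm{vec}(\mathcal W')\|_M$. Then $\Omega\neq\emptyset$ and $M\succ0$, and for every sequence $\{\mathcal W^k\}$ generated by the sGS-ADMM there is a constant $\rho\in(0,1)$ such that for all $k\ge1$ $$\mathrm{dist}_M^2(\mathcal W^{k+1},\Omega)+\beta\bigl\|[y^{k+1};z^{k+1}]-[y^k;z^k]\bigr\|_C^2\le\rho\Bigl(\mathrm{dist}_M^2(\mathcal W^{k},\Omega)+\beta\bigl\|[y^{k};z^{k}]-[y^{k-1};z^{k-1}]\bigr\|_C^2\Bigr).$$ -/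

import Mathlib

open scoped Matrix

noncomputable section

namespace WassersteinBarycenter

/-! ### Convex analysis -/

section Convex

/-- The trace (Frobenius) inner product `⟨X, Y⟩ = ∑ᵢⱼ Xᵢⱼ Yᵢⱼ` of two real matrices. -/
def frob {p q : ℕ} (X Y : Matrix (Fin p) (Fin q) ℝ) : ℝ :=
  ∑ i, ∑ j, X i j * Y i j

open Classical in
/-- The indicator function of a set: `0` on the set and `+∞` off it. -/
def indicatorFn {E : Type*} (S : Set E) (x : E) : EReal :=
  if x ∈ S then 0 else ⊤

/-- The conjugate `f*(y) = sup { ⟨y, x⟩ - f(x) : x ∈ ℝⁿ }`. -/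
def conj {n : ℕ} (f : (Fin n → ℝ) → EReal) (y : Fin n → ℝ) : EReal :=
  ⨆ x : Fin n → ℝ, (((y ⬝ᵥ x : ℝ) : EReal) - f x)

/-- The subdifferential `∂f(x) = { d : f(y) ≥ f(x) + ⟨d, y - x⟩ for all y }` at `x ∈ dom f`,
for the inner product `ip`. -/
def subdiff {E : Type*} [Sub E] (ip : E → E → ℝ) (f : E → EReal) (x : E) : Set E :=
  {d | f x < ⊤ ∧ ∀ y : E, f x + ((ip d (y - x) : ℝ) : EReal) ≤ f y}

/-- The support function `δ*_Δ` of the unit simplex `Δ_m`, as the conjugate of the indicator. -/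
def simplexConj (m : ℕ) : (Fin m → ℝ) → EReal :=
  conj (indicatorFn (stdSimplex ℝ (Fin m)))

/-- The indicator function `δ_+` of the entrywise nonnegative matrices. -/
def nonnegInd (p q : ℕ) : Matrix (Fin p) (Fin q) ℝ → EReal :=
  indicatorFn {V : Matrix (Fin p) (Fin q) ℝ | ∀ i j, 0 ≤ V i j}

/-- The weighted norm `‖x‖_T = √⟨x, T x⟩`. -/
def wnorm {ι : Type*} [Fintype ι] (T : Matrix ι ι ℝ) (x : ι → ℝ) : ℝ :=
  Real.sqrt (x ⬝ᵥ (T *ᵥ x))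

end Convex

/-! ### The dual problem, its augmented Lagrangian and its KKT system -/

section Problem

/-- A point `(u, {V⁽ᵗ⁾}, {y⁽ᵗ⁾}, {z⁽ᵗ⁾}, λ, {Λ⁽ᵗ⁾})` of the primal-dual space. Here `N` is the number
of given distributions, `m` the number of support points of the barycenter, and `mt t` the
number of support points of the `t`-th distribution. -/
@[ext]
structure Point {N : ℕ} (m : ℕ) (mt : Fin N → ℕ) where
  u : Fin m → ℝ
  V : (t : Fin N) → Matrix (Fin m) (Fin (mt t)) ℝ
  y : Fin N → Fin m → ℝ
  z : (t : Fin N) → Fin (mt t) → ℝ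
  lam : Fin m → ℝ
  Lam : (t : Fin N) → Matrix (Fin m) (Fin (mt t)) ℝ

variable {N m : ℕ} {mt : Fin N → ℕ}

/-- The residual `∑ₜ y⁽ᵗ⁾ - u` of the first constraint. -/
def res₁ (u : Fin m → ℝ) (y : Fin N → Fin m → ℝ) : Fin m → ℝ :=
  (∑ t, y t) - u

/-- The residual `V⁽ᵗ⁾ - D⁽ᵗ⁾ - y⁽ᵗ⁾ eᵀ - e (z⁽ᵗ⁾)ᵀ` of the second constraint. -/
def res₂ (D V : (t : Fin N) → Matrix (Fin m) (Fin (mt t)) ℝ)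
    (y : Fin N → Fin m → ℝ) (z : (t : Fin N) → Fin (mt t) → ℝ) (t : Fin N) :
    Matrix (Fin m) (Fin (mt t)) ℝ :=
  V t - D t - Matrix.vecMulVec (y t) (fun _ => 1) - Matrix.vecMulVec (fun _ => 1) (z t)

/-- The augmented Lagrangian `𝓛_β` of the dual problem
`min δ*_Δ(u) + ∑ₜ δ_+(V⁽ᵗ⁾) + ∑ₜ ⟨z⁽ᵗ⁾, a⁽ᵗ⁾⟩` subject to
`∑ₜ y⁽ᵗ⁾ - u = 0` and `V⁽ᵗ⁾ - D⁽ᵗ⁾ - y⁽ᵗ⁾ eᵀ - e (z⁽ᵗ⁾)ᵀ = 0` for all `t`. -/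
def augLag (D : (t : Fin N) → Matrix (Fin m) (Fin (mt t)) ℝ) (a : (t : Fin N) → Fin (mt t) → ℝ)
    (β : ℝ) (u : Fin m → ℝ) (V : (t : Fin N) → Matrix (Fin m) (Fin (mt t)) ℝ)
    (y : Fin N → Fin m → ℝ) (z : (t : Fin N) → Fin (mt t) → ℝ)
    (lam : Fin m → ℝ) (Lam : (t : Fin N) → Matrix (Fin m) (Fin (mt t)) ℝ) : EReal :=
  simplexConj m u + (∑ t, nonnegInd m (mt t) (V t)) +
    (((∑ t, z t ⬝ᵥ a t) + lam ⬝ᵥ res₁ u y + (∑ t, frob (Lam t) (res₂ D V y z t))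
      + β / 2 * (res₁ u y ⬝ᵥ res₁ u y)
      + β / 2 * (∑ t, frob (res₂ D V y z t) (res₂ D V y z t)) : ℝ) : EReal)

/-- The KKT system of the dual problem. -/
structure IsKKT (D : (t : Fin N) → Matrix (Fin m) (Fin (mt t)) ℝ)
    (a : (t : Fin N) → Fin (mt t) → ℝ) (W : Point m mt) : Prop where
  /-- `0 ∈ ∂δ*_Δ(u) - λ` -/
  stat_u : W.lam ∈ subdiff (fun x y => x ⬝ᵥ y) (simplexConj m) W.u
  /-- `0 ∈ ∂δ_+(V⁽ᵗ⁾) + Λ⁽ᵗ⁾` -/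
  stat_V : ∀ t, -W.Lam t ∈ subdiff frob (nonnegInd m (mt t)) (W.V t)
  /-- `Λ⁽ᵗ⁾ e = λ` -/
  stat_y : ∀ t, W.Lam t *ᵥ (fun _ => 1) = W.lam
  /-- `(Λ⁽ᵗ⁾)ᵀ e = a⁽ᵗ⁾` -/
  stat_z : ∀ t, (W.Lam t)ᵀ *ᵥ (fun _ => 1) = a t
  feas₁ : res₁ W.u W.y = 0
  feas₂ : ∀ t, res₂ D W.V W.y W.z t = 0

/-- The solution set `Ω` of the KKT system. -/
def kktSet (D : (t : Fin N) → Matrix (Fin m) (Fin (mt t)) ℝ)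
    (a : (t : Fin N) → Fin (mt t) → ℝ) : Set (Point m mt) :=
  {W | IsKKT D a W}

end Problem

/-! ### The algorithm -/

section Algorithm

variable {N m : ℕ} {mt : Fin N → ℕ}

/-- One iteration of the sGS-ADMM leads from `W` to `W'`. -/
def IsStep (D : (t : Fin N) → Matrix (Fin m) (Fin (mt t)) ℝ)
    (a : (t : Fin N) → Fin (mt t) → ℝ) (β τ : ℝ) (W W' : Point m mt) : Prop :=
  -- Step 1: joint minimization in `(u, V)`
  IsMinOn (fun p : (Fin m → ℝ) × ((t : Fin N) → Matrix (Fin m) (Fin (mt t)) ℝ) =>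
      augLag D a β p.1 p.2 W.y W.z W.lam W.Lam) Set.univ (W'.u, W'.V) ∧
  (∃ ztil : (t : Fin N) → Fin (mt t) → ℝ,
    -- Step 2a: minimization in `z`
    IsMinOn (fun z => augLag D a β W'.u W'.V W.y z W.lam W.Lam) Set.univ ztil ∧
    -- Step 2b: minimization in `y`
    IsMinOn (fun y => augLag D a β W'.u W'.V y ztil W.lam W.Lam) Set.univ W'.y) ∧
  -- Step 2c: minimization in `z`
  IsMinOn (fun z => augLag D a β W'.u W'.V W'.y z W.lam W.Lam) Set.univ W'.z ∧
  -- Step 3: multiplier update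
  W'.lam = W.lam + (τ * β) • res₁ W'.u W'.y ∧
  ∀ t, W'.Lam t = W.Lam t + (τ * β) • res₂ D W'.V W'.y W'.z t

/-- `W 0, W 1, W 2, …` is generated by the sGS-ADMM, from an arbitrary starting point
with `V⁽ᵗ⁾ ≥ 0`. -/
def IsSGSADMM (D : (t : Fin N) → Matrix (Fin m) (Fin (mt t)) ℝ)
    (a : (t : Fin N) → Fin (mt t) → ℝ) (β τ : ℝ) (W : ℕ → Point m mt) : Prop :=
  (∀ t i j, 0 ≤ (W 0).V t i j) ∧ ∀ k, IsStep D a β τ (W k) (W (k + 1))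

end Algorithm

/-! ### The matrices of the compact form and the weighted distance -/

section Matrices

variable {N : ℕ} (m : ℕ) (mt : Fin N → ℕ)

/-- Coordinates of `[u; v]` (and of `[λ; vec Λ]`, and of the constraints). -/
abbrev UV : Type := Fin m ⊕ (t : Fin N) × (Fin m × Fin (mt t))

/-- Coordinates of `y`. -/
abbrev YIdx (N m : ℕ) : Type := Fin N × Fin m

/-- Coordinates of `z`. -/
abbrev ZIdx {N : ℕ} (mt : Fin N → ℕ) : Type := (t : Fin N) × Fin (mt t)

/-- Coordinates of `vec 𝒲 = [u; v; y; z; λ; vec Λ]`. -/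
abbrev FullIdx : Type := UV m mt ⊕ ((YIdx N m ⊕ ZIdx mt) ⊕ UV m mt)

/-- `A [u; v] = [-u; v]`. -/
def matA : Matrix (UV m mt) (UV m mt) ℝ :=
  Matrix.fromBlocks (-1) 0 0 1

/-- `B₁ y = [∑ₜ y⁽ᵗ⁾; -vec (y⁽¹⁾ eᵀ); …; -vec (y⁽ᴺ⁾ eᵀ)]`. -/
def matB₁ : Matrix (UV m mt) (YIdx N m) ℝ :=
  Matrix.fromRows
    (Matrix.of fun i q => if i = q.2 then 1 else 0)
    (Matrix.of fun r q => if r.1 = q.1 ∧ r.2.1 = q.2 then -1 else 0)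

/-- `B₂ z = [0; -vec (e (z⁽¹⁾)ᵀ); …; -vec (e (z⁽ᴺ⁾)ᵀ)]`. -/
def matB₂ : Matrix (UV m mt) (ZIdx mt) ℝ :=
  Matrix.fromRows 0
    (Matrix.of fun r q => if (⟨r.1, r.2.2⟩ : ZIdx mt) = q then -1 else 0)

/-- `B = [B₁ B₂]`. -/
def matB : Matrix (UV m mt) (YIdx N m ⊕ ZIdx mt) ℝ :=
  Matrix.fromCols (matB₁ m mt) (matB₂ m mt)

/-- The symmetric Gauss–Seidel operator `C = diag(B₁ᵀ B₂ (B₂ᵀ B₂)⁻¹ B₂ᵀ B₁, 0)` of `Bᵀ B`. -/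
def matC : Matrix (YIdx N m ⊕ ZIdx mt) (YIdx N m ⊕ ZIdx mt) ℝ :=
  Matrix.fromBlocks
    ((matB₁ m mt)ᵀ * matB₂ m mt * ((matB₂ m mt)ᵀ * matB₂ m mt)⁻¹ * (matB₂ m mt)ᵀ * matB₁ m mt)
    0 0 0

/-- `s_τ = (5 - τ - 3 min{τ, τ⁻¹}) / 4`. -/
def sCoef (τ : ℝ) : ℝ := (5 - τ - 3 * min τ τ⁻¹) / 4

/-- The weight matrix
`M = diag(0, βC + βBᵀB, (τβ)⁻¹ I) + s_τ β [AᵀA, AᵀB, 0; BᵀA, BᵀB, 0; 0, 0, 0]`. -/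
def matM (β τ : ℝ) : Matrix (FullIdx m mt) (FullIdx m mt) ℝ :=
  Matrix.fromBlocks 0 0 0
    (Matrix.fromBlocks (β • matC m mt + β • ((matB m mt)ᵀ * matB m mt)) 0 0
      ((τ * β)⁻¹ • (1 : Matrix (UV m mt) (UV m mt) ℝ))) +
  (sCoef τ * β) •
    Matrix.fromBlocks ((matA m mt)ᵀ * matA m mt)
      (Matrix.fromCols ((matA m mt)ᵀ * matB m mt) 0)
      (Matrix.fromRows ((matB m mt)ᵀ * matA m mt) 0)
      (Matrix.fromBlocks ((matB m mt)ᵀ * matB m mt) 0 0 0)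

variable {m mt}

/-- The vector `[x; vec X]` of a vector and a family of matrices. -/
def vecUV (x : Fin m → ℝ) (X : (t : Fin N) → Matrix (Fin m) (Fin (mt t)) ℝ) : UV m mt → ℝ :=
  Sum.elim x (fun r => X r.1 r.2.1 r.2.2)

/-- The vector `[y; z]`. -/
def vecYZ (y : Fin N → Fin m → ℝ) (z : (t : Fin N) → Fin (mt t) → ℝ) :
    YIdx N m ⊕ ZIdx mt → ℝ :=
  Sum.elim (fun q => y q.1 q.2) (fun q => z q.1 q.2)

/-- `vec 𝒲 = [u; v; y; z; λ; vec Λ]`. -/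
def Point.vec (W : Point m mt) : FullIdx m mt → ℝ :=
  Sum.elim (vecUV W.u W.V) (Sum.elim (vecYZ W.y W.z) (vecUV W.lam W.Lam))

/-- `dist_M(𝒲, S) = inf { ‖vec 𝒲 - vec 𝒲'‖_M : 𝒲' ∈ S }`. -/
def distM (M : Matrix (FullIdx m mt) (FullIdx m mt) ℝ) (W : Point m mt)
    (S : Set (Point m mt)) : ℝ :=
  sInf ((fun W' : Point m mt => wnorm M (W.vec - W'.vec)) '' S)

end Matrices

end WassersteinBarycenter

end

/-!
The sGS-ADMM for the Wasserstein barycenter problem converges linearly because its energy decreases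
by a quantity that also bounds the distance to the solution set.

Write `x = [u; v]`, `w = [y; z]`, `l = [λ; vec Λ]` and `r = A x + B w - [0; vec D]`. The two sweeps
over `z` around the minimisation over `y` are equivalent to one minimisation over `w` with the
proximal term `β/2 ‖w - wᵏ‖_C²` (`IsStep.conditions`). So the algorithm is a semi-proximal ADMM
with two blocks, and the optimality conditions of an iteration, combined with the monotonicity of
`∂δ*_Δ` and `∂δ_+`, show that for every KKT point `𝒲*` the energy
`‖𝒲ᵏ - 𝒲*‖_M² + β ‖Δᵏ‖_C²`, `Δᵏ = wᵏ - wᵏ⁻¹`, decreases by at least a constant times the progress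
`S = ‖Δᵏ⁺¹‖_C² + ‖B Δᵏ⁺¹‖² + ‖rᵏ⁺¹‖²` (`energy_decrease`). This is where `τ < (1 + √5) / 2` enters,
through `(1 - τ)² < s_τ < 2 - τ`. Since the inequality holds for all `𝒲*`, it holds for
`dist_M²(𝒲ᵏ, Ω)`.

Conversely `dist_M²(𝒲ᵏ⁺¹, Ω)` is at most a constant times `S` (`exists_error_bound`). Replacing
complementarity by the condition that the duality gap is nonpositive exhibits a system of linear
inequalities all of whose solutions lie in `Ω` (`exists_isKKT_of_system`), so Hoffman's error bound
(`hoffman`) applies. The residuals of the system at `𝒲ᵏ⁺¹`, with a slightly different multiplier,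
are of order `√S`, except that the gap is of this order only on bounded sets. The iterates are
bounded by the decrease of the energy (`exists_iterate_bound`); hence the rate depends on the
sequence. The two inequalities together give a contraction.

Farkas' lemma for finitely generated cones, whose closedness comes from the conic form of
Carathéodory's theorem, gives Hoffman's bound and also the multipliers of linear programs
(`lp_multipliers`), which show that `Ω` is not empty. The matrix `M` is positive definite although
`B` has a kernel for `N > 1`: the Gauss–Seidel term `C` is definite on it.
-/

open scoped Matrix

noncomputable section

namespace WassersteinBarycenter

/-! ### Polyhedra: Farkas' lemma and Hoffman's error bound -/

section Polyhedral

variable {E ι : Type*}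

/-- Conic Carathéodory theorem: a conic combination can be rewritten with linearly independent
generators. -/
theorem exists_linearIndepOn_conic_combination [AddCommGroup E] [Module ℝ E] (v : ι → E)
    (s : Finset ι) (c : ι → ℝ) (hc : ∀ i, 0 ≤ c i) :
    ∃ t ⊆ s, LinearIndepOn ℝ v (t : Set ι) ∧
      ∃ c' : ι → ℝ, (∀ i, 0 ≤ c' i) ∧ ∑ i ∈ t, c' i • v i = ∑ i ∈ s, c i • v i := by
  classical
  induction s using Finset.strongInduction generalizing c with
  | H s ih =>
    by_cases hli : LinearIndepOn ℝ v (s : Set ι)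
    · exact ⟨s, subset_rfl, hli, c, hc, rfl⟩
    obtain ⟨g, hg0, i₁, hi₁, hgi₁⟩ :
        ∃ g : ι → ℝ, ∑ i ∈ s, g i • v i = 0 ∧ ∃ i ∈ s, 0 < g i := by
      rw [linearIndepOn_finset_iff] at hli
      push Not at hli
      obtain ⟨g, hg0, i, hi, hgi⟩ := hli
      rcases lt_or_gt_of_ne hgi with h | h
      · exact ⟨-g, by simp [hg0], i, hi, by simpa using h⟩
      · exact ⟨g, hg0, i, hi, h⟩
    obtain ⟨i₀, hi₀, hmin⟩ := (s.filter fun i => 0 < g i).exists_min_image (fun i => c i / g i)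
      ⟨i₁, by simp [hi₁, hgi₁]⟩
    rw [Finset.mem_filter] at hi₀
    have hk : ∀ i ∈ s, 0 ≤ c i - c i₀ / g i₀ * g i := by
      intro i hi
      rcases lt_or_ge 0 (g i) with h | h
      · have := hmin i (by simp [hi, h])
        rw [le_div_iff₀ h] at this
        linarith
      · have : c i₀ / g i₀ * g i ≤ 0 :=
          mul_nonpos_of_nonneg_of_nonpos (div_nonneg (hc _) hi₀.2.le) h
        linarith [hc i]
    obtain ⟨t, ht, hlt, c', hc', hsum⟩ := ih (s.erase i₀) (Finset.erase_ssubset hi₀.1)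
      (fun i => if i ∈ s then c i - c i₀ / g i₀ * g i else 0)
      (fun i => by split_ifs with h; exacts [hk i h, le_rfl])
    refine ⟨t, ht.trans (Finset.erase_subset _ _), hlt, c', hc', hsum.trans ?_⟩
    rw [Finset.sum_erase _ (by simp [hi₀.1, hi₀.2.ne'])]
    calc _ = ∑ i ∈ s, (c i • v i - (c i₀ / g i₀) • (g i • v i)) :=
          Finset.sum_congr rfl fun i hi => by simp [hi, sub_smul, mul_smul]
      _ = _ := by rw [Finset.sum_sub_distrib, ← Finset.smul_sum, hg0, smul_zero, sub_zero]

variable [NormedAddCommGroup E] [InnerProductSpace ℝ E]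

/-- Linear combinations of the vectors `v i`, `i ∈ t`, as a function of the coefficients. -/
def combination (v : ι → E) (t : Finset ι) : (t → ℝ) →ₗ[ℝ] E :=
  Fintype.linearCombination ℝ (fun i : t => v i)

theorem combination_apply (v : ι → E) (t : Finset ι) (c : ι → ℝ) :
    combination v t (fun i => c i) = ∑ i ∈ t, c i • v i := by
  rw [combination, Fintype.linearCombination_apply, ← Finset.sum_coe_sort t]

theorem combination_injective {v : ι → E} {t : Finset ι} (h : LinearIndepOn ℝ v (t : Set ι)) :
    Function.Injective (combination v t) :=
  LinearIndependent.fintypeLinearCombination_injective h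

/-- The cone generated by the `v i`, `i ∈ s`. -/
def finCone (v : ι → E) (s : Finset ι) : PointedCone ℝ E where
  carrier := {g | ∃ c : ι → ℝ, (∀ i, 0 ≤ c i) ∧ ∑ i ∈ s, c i • v i = g}
  zero_mem' := ⟨0, fun _ => le_rfl, by simp⟩
  add_mem' := by
    rintro _ _ ⟨c, hc, rfl⟩ ⟨d, hd, rfl⟩
    exact ⟨c + d, fun i => add_nonneg (hc i) (hd i), by simp [add_smul, Finset.sum_add_distrib]⟩
  smul_mem' := by
    rintro r _ ⟨c, hc, rfl⟩
    exact ⟨fun i => r * c i, fun i => mul_nonneg r.2 (hc i), by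
      rw [Finset.smul_sum]
      exact Finset.sum_congr rfl fun i _ => by rw [mul_smul]; rfl⟩

/-- A finitely generated cone is the finite union of the simplicial cones spanned by its linearly
independent subfamilies, each of which is a linear embedding of an orthant. -/
theorem isClosed_finCone (v : ι → E) (s : Finset ι) :
    IsClosed (finCone v s : Set E) := by
  classical
  have : (finCone v s : Set E) = 
      ⋃ t ∈ s.powerset.filter fun t : Finset ι => LinearIndepOn ℝ v (t : Set ι),
        combination v t '' {c | ∀ i, 0 ≤ c i} := by
    ext g
    simp only [Set.mem_iUnion, Finset.mem_filter, Finset.mem_powerset, exists_prop]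
    constructor
    · rintro ⟨c, hc, rfl⟩
      obtain ⟨t, ht, hli, c', hc', h⟩ := exists_linearIndepOn_conic_combination v s c hc
      exact ⟨t, ⟨ht, hli⟩, fun i => c' i, fun i => hc' i, by rw [combination_apply, h]⟩
    · rintro ⟨t, ⟨ht, hli⟩, c, hc, rfl⟩
      refine ⟨fun i => if h : i ∈ t then c ⟨i, h⟩ else 0,
        fun i => by dsimp only; split_ifs with h; exacts [hc _, le_rfl], ?_⟩
      rw [← Finset.sum_subset ht fun i _ hi => by simp [hi], ← combination_apply]
      congr 1
      ext i
      simp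
  rw [this]
  refine isClosed_biUnion_finset fun t ht => ?_
  refine (LinearMap.isClosedEmbedding_of_injective (LinearMap.ker_eq_bot.2
    (combination_injective (Finset.mem_filter.1 ht).2))).isClosedMap _ ?_
  simp only [Set.ofPred_forall]
  exact isClosed_iInter fun i => isClosed_le continuous_const (continuous_apply i)

/-- Farkas' lemma: a vector that has nonpositive inner product with every element of the polar
of the `v i`, `i ∈ s`, is a conic combination of them. -/
theorem mem_finCone_of_polar [CompleteSpace E] (v : ι → E) (s : Finset ι) (g : E)
    (h : ∀ d, (∀ i ∈ s, inner ℝ (v i) d ≤ 0) → inner ℝ g d ≤ 0) : g ∈ finCone v s := by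
  classical
  by_contra hg
  obtain ⟨y, hy, hgy⟩ := ProperCone.hyperplane_separation'
    (⟨finCone v s, isClosed_finCone v s⟩ : ProperCone ℝ E) hg
  have := h (-y) fun i hi => by
    have := hy (v i) ⟨Pi.single i 1, fun j => by
      by_cases hj : j = i
      · subst hj; simp
      · simp [hj], by
      rw [Finset.sum_eq_single i (fun j _ hj => by simp [hj]) (fun h => absurd hi h)]
      simp⟩
    rw [inner_neg_right]
    linarith
  rw [inner_neg_right] at this
  linarith

/-- The coefficients of a conic combination can be bounded by the norm of the vector, uniformly
over all subfamilies. -/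
theorem exists_bound_conic_coefficients [Fintype ι] (v : ι → E) :
    ∃ K : ℝ, 0 ≤ K ∧ ∀ (s : Finset ι), ∀ g ∈ finCone v s, ∃ c : ι → ℝ, (∀ i, 0 ≤ c i) ∧
      (∀ i, i ∉ s → c i = 0) ∧ (∀ i, c i ≤ K * ‖g‖) ∧ ∑ i, c i • v i = g := by
  classical
  have key : ∀ t : Finset ι, ∃ K : ℝ, 0 ≤ K ∧ (LinearIndepOn ℝ v (t : Set ι) →
      ∀ c : t → ℝ, ‖c‖ ≤ K * ‖combination v t c‖) := by
    intro t
    by_cases h : LinearIndepOn ℝ v (t : Set ι)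
    · obtain ⟨K, -, hK⟩ := (combination v t).exists_antilipschitzWith
        (LinearMap.ker_eq_bot.2 (combination_injective h))
      exact ⟨K, K.2, fun _ c => by simpa using hK.le_mul_dist c 0⟩
    · exact ⟨0, le_rfl, fun h' => absurd h' h⟩
  choose K hK0 hK using key
  refine ⟨∑ t, K t, Finset.sum_nonneg fun t _ => hK0 t, ?_⟩
  rintro s _ ⟨c, hc, rfl⟩
  obtain ⟨t, ht, hli, c', hc', h⟩ := exists_linearIndepOn_conic_combination v s c hc
  refine ⟨fun i => if i ∈ t then c' i else 0,
    fun i => by dsimp only; split_ifs with h; exacts [hc' _, le_rfl],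
    fun i hi => if_neg fun hit => hi (ht hit), fun i => ?_, ?_⟩
  · have hKt : K t ≤ ∑ t, K t := Finset.single_le_sum (fun t _ => hK0 t) (Finset.mem_univ t)
    dsimp only
    split_ifs with hi
    · have h1 := hK t hli (fun i => c' i)
      rw [combination_apply, h] at h1
      have h2 := norm_le_pi_norm (fun i : t => c' i) ⟨i, hi⟩
      rw [Real.norm_eq_abs] at h2
      calc c' i ≤ |c' i| := le_abs_self _
        _ ≤ _ := h2.trans (h1.trans (by gcongr))
    · exact mul_nonneg ((hK0 t).trans hKt) (norm_nonneg _)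
  · rw [← h]
    simp [ite_smul]

/-- First-order optimality for linear programs: if `p` maximises `⟪g, ·⟫` over a polyhedron, then
`g` lies in the cone generated by the normals of the constraints active at `p`. -/
theorem mem_finCone_active [CompleteSpace E] [Fintype ι] (v : ι → E) (b : ι → ℝ) (p g : E)
    (hp : ∀ i, inner ℝ (v i) p ≤ b i)
    (hmax : ∀ x, (∀ i, inner ℝ (v i) x ≤ b i) → inner ℝ g x ≤ inner ℝ g p) :
    g ∈ finCone v (Finset.univ.filter fun i => inner ℝ (v i) p = b i) := by
  refine mem_finCone_of_polar v _ g fun d hd => ?_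
  have hev : ∀ᶠ ε : ℝ in nhdsWithin 0 (Set.Ioi 0), ∀ i, inner ℝ (v i) (p + ε • d) ≤ b i := by
    rw [Filter.eventually_all]
    intro i
    rcases (hp i).eq_or_lt with h | h
    · filter_upwards [self_mem_nhdsWithin] with ε hε
      have := hd i (by simp [h])
      rw [inner_add_right, inner_smul_right, h]
      nlinarith [Set.mem_Ioi.1 hε]
    · have hc : Continuous fun ε : ℝ => inner ℝ (v i) (p + ε • d) := by fun_prop
      have := hc.tendsto 0
      simp only [zero_smul, add_zero] at this
      exact ((this.eventually (gt_mem_nhds h)).filter_mono nhdsWithin_le_nhds).mono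
        fun _ h => h.le
  obtain ⟨ε, hε, hε0⟩ := (hev.and self_mem_nhdsWithin).exists
  have := hmax _ hε
  rw [inner_add_right, inner_smul_right] at this
  by_contra! hlt
  nlinarith [mul_pos (Set.mem_Ioi.1 hε0) hlt]

/-- Hoffman's error bound: the distance to a nonempty polyhedron is at most a constant times the
total violation of its constraints. If `p` is the projection of `x`, then `x - p` is a conic
combination of active normals with coefficients bounded by a multiple of `‖x - p‖`. -/
theorem hoffman_inner [CompleteSpace E] [Fintype ι] (v : ι → E) (b : ι → ℝ)
    (hne : ∃ x, ∀ i, inner ℝ (v i) x ≤ b i) :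
    ∃ K : ℝ, 0 ≤ K ∧ ∀ x, ∃ p, (∀ i, inner ℝ (v i) p ≤ b i) ∧
      ‖x - p‖ ≤ K * ∑ i, max (inner ℝ (v i) x - b i) 0 := by
  obtain ⟨K, hK0, hK⟩ := exists_bound_conic_coefficients v
  refine ⟨K, hK0, fun x => ?_⟩
  have hconv : Convex ℝ {x | ∀ i, inner ℝ (v i) x ≤ b i} := by
    simp only [Set.ofPred_forall]
    exact convex_iInter fun i => convex_halfSpace_le (innerₗ E (v i)).isLinear _
  have hclosed : IsClosed {x | ∀ i, inner ℝ (v i) x ≤ b i} := by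
    simp only [Set.ofPred_forall]
    exact isClosed_iInter fun i => isClosed_le (by fun_prop) continuous_const
  obtain ⟨p, hp, hmin⟩ := exists_norm_eq_iInf_of_complete_convex
    (K := {x | ∀ i, inner ℝ (v i) x ≤ b i}) hne hclosed.isComplete hconv x
  rw [norm_eq_iInf_iff_real_inner_le_zero hconv hp] at hmin
  refine ⟨p, hp, ?_⟩
  obtain ⟨c, hc0, hca, hcK, hcs⟩ := hK _ _ (mem_finCone_active v b p (x - p) hp fun w hw => by
    have := hmin w hw
    rw [inner_sub_right] at this
    linarith)
  have hsq : ‖x - p‖ * ‖x - p‖ ≤ (K * ∑ i, max (inner ℝ (v i) x - b i) 0) * ‖x - p‖ := by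
    calc ‖x - p‖ * ‖x - p‖ = inner ℝ (∑ i, c i • v i) (x - p) := by
          rw [hcs, real_inner_self_eq_norm_mul_norm]
      _ = ∑ i, c i * (inner ℝ (v i) x - b i) := by
          rw [sum_inner]
          refine Finset.sum_congr rfl fun i _ => ?_
          rw [inner_smul_left, inner_sub_right]
          by_cases hi : inner ℝ (v i) p = b i
          · simp [hi]
          · simp [hca i (by simp [hi])]
      _ ≤ ∑ i, (K * ‖x - p‖) * max (inner ℝ (v i) x - b i) 0 := by
          refine Finset.sum_le_sum fun i _ => ?_
          exact (mul_le_mul_of_nonneg_left (le_max_left _ 0) (hc0 i)).trans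
            (mul_le_mul_of_nonneg_right (hcK i) (le_max_right _ _))
      _ = _ := by rw [← Finset.mul_sum]; ring
  rcases (norm_nonneg (x - p)).eq_or_lt with h | h
  · rw [← h]
    exact mul_nonneg hK0 (Finset.sum_nonneg fun i _ => le_max_right _ _)
  · exact le_of_mul_le_mul_right hsq h

end Polyhedral

section LinearSystem

variable {F ι κ : Type*} [NormedAddCommGroup F] [NormedSpace ℝ F] [FiniteDimensional ℝ F]

/-- A linear functional on `F`, as a vector of the Euclidean space of the same dimension. -/
def rieszVec (f : F →ₗ[ℝ] ℝ) : EuclideanSpace ℝ (Fin (Module.finrank ℝ F)) :=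
  (InnerProductSpace.toDual ℝ _).symm
    (LinearMap.toContinuousLinearMap (f ∘ₗ (toEuclidean (E := F)).symm.toLinearMap))

theorem inner_rieszVec (f : F →ₗ[ℝ] ℝ) (x : F) :
    inner ℝ (rieszVec f) (toEuclidean x) = f x := by
  simp [rieszVec]

/-- The normals of the system `G x ≤ b`, `H x = d`, each equation being split into two
inequalities. -/
def systemNormal (G : F →ₗ[ℝ] (ι → ℝ)) (H : F →ₗ[ℝ] (κ → ℝ)) :
    ι ⊕ (κ ⊕ κ) → EuclideanSpace ℝ (Fin (Module.finrank ℝ F)) :=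
  Sum.elim (fun i => rieszVec (LinearMap.proj i ∘ₗ G))
    (Sum.elim (fun j => rieszVec (LinearMap.proj j ∘ₗ H))
      (fun j => rieszVec (-(LinearMap.proj j ∘ₗ H))))

/-- The right-hand sides that belong to `systemNormal`. -/
def systemRhs (b : ι → ℝ) (d : κ → ℝ) : ι ⊕ (κ ⊕ κ) → ℝ :=
  Sum.elim b (Sum.elim d (-d))

theorem system_iff (G : F →ₗ[ℝ] (ι → ℝ)) (H : F →ₗ[ℝ] (κ → ℝ)) (b : ι → ℝ) (d : κ → ℝ) (x : F) :
    (∀ i, inner ℝ (systemNormal G H i) (toEuclidean x) ≤ systemRhs b d i) ↔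
      (∀ i, G x i ≤ b i) ∧ H x = d := by
  simp only [systemNormal, systemRhs, Sum.forall, Sum.elim_inl, Sum.elim_inr, inner_rieszVec,
    funext_iff, Pi.neg_apply, LinearMap.neg_apply, LinearMap.comp_apply, LinearMap.proj_apply,
    neg_le_neg_iff, ← forall_and, ← le_antisymm_iff]

/-- Hoffman's error bound for a system of linear inequalities and equations. -/
theorem hoffman [Fintype ι] [Fintype κ] (G : F →ₗ[ℝ] (ι → ℝ)) (H : F →ₗ[ℝ] (κ → ℝ))
    (b : ι → ℝ) (d : κ → ℝ)
    (hne : ∃ x, (∀ i, G x i ≤ b i) ∧ H x = d) :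
    ∃ K : ℝ, 0 ≤ K ∧ ∀ x ε, 0 ≤ ε → (∀ i, G x i ≤ b i + ε) → (∀ j, |H x j - d j| ≤ ε) →
      ∃ p, ((∀ i, G p i ≤ b i) ∧ H p = d) ∧ ‖x - p‖ ≤ K * ε := by
  obtain ⟨K, hK0, hK⟩ := hoffman_inner (systemNormal G H) (systemRhs b d) (by
    obtain ⟨x, hx⟩ := hne
    exact ⟨toEuclidean x, (system_iff G H b d x).2 hx⟩)
  obtain ⟨L, hL0, hL⟩ := (toEuclidean (E := F)).symm.toContinuousLinearMap.isBoundedLinearMap.bound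
  refine ⟨L * (K * Fintype.card (ι ⊕ (κ ⊕ κ))), by positivity, fun x ε hε h1 h2 => ?_⟩
  obtain ⟨p, hp, hxp⟩ := hK (toEuclidean x)
  have hv : ∀ i, max (inner ℝ (systemNormal G H i) (toEuclidean x) - systemRhs b d i) 0 ≤ ε := by
    refine fun i => max_le ?_ hε
    rcases i with i | j | j
    · simpa [systemNormal, systemRhs, inner_rieszVec, add_comm] using h1 i
    · simpa [systemNormal, systemRhs, inner_rieszVec] using (le_abs_self _).trans (h2 j)
    · have := (neg_le_abs _).trans (h2 j)
      simp only [systemNormal, systemRhs, Sum.elim_inr, inner_rieszVec, Pi.neg_apply,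
        LinearMap.neg_apply, LinearMap.comp_apply, LinearMap.proj_apply]
      linarith
  refine ⟨(toEuclidean (E := F)).symm p, (system_iff G H b d _).1 (by simpa using hp), ?_⟩
  have h3 := hL (toEuclidean x - p)
  simp only [map_sub, ContinuousLinearEquiv.coe_coe, ContinuousLinearEquiv.symm_apply_apply] at h3
  calc _ ≤ L * ‖toEuclidean x - p‖ := h3
    _ ≤ L * (K * ∑ _i : ι ⊕ (κ ⊕ κ), ε) := by gcongr; exact hxp.trans (by gcongr; exact hv _)
    _ = _ := by rw [Finset.sum_const, Finset.card_univ, nsmul_eq_mul]; ring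

/-- Lagrange multipliers for linear programs: if `p` maximises `g` subject to `G x ≤ b` and
`H x = d`, then `g` is a combination of the constraints, with nonnegative coefficients at the
inequalities, which vanish at the inactive ones. -/
theorem lp_multipliers [Fintype ι] [Fintype κ] (G : F →ₗ[ℝ] (ι → ℝ)) (H : F →ₗ[ℝ] (κ → ℝ))
    (b : ι → ℝ) (d : κ → ℝ)
    (g : F →ₗ[ℝ] ℝ) (p : F) (hp : (∀ i, G p i ≤ b i) ∧ H p = d)
    (hmax : ∀ x, (∀ i, G x i ≤ b i) → H x = d → g x ≤ g p) :
    ∃ (s : ι → ℝ) (w : κ → ℝ), (∀ i, 0 ≤ s i) ∧ (∀ i, s i * (b i - G p i) = 0) ∧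
      ∀ x, g x = s ⬝ᵥ G x + w ⬝ᵥ H x := by
  obtain ⟨K, -, hK⟩ := exists_bound_conic_coefficients (systemNormal G H)
  obtain ⟨c, hc0, hca, -, hcs⟩ := hK _ _ (mem_finCone_active (systemNormal G H) (systemRhs b d)
    (toEuclidean p) (rieszVec g) ((system_iff G H b d p).2 hp) fun x hx => by
      obtain ⟨x, rfl⟩ := (toEuclidean (E := F)).surjective x
      rw [system_iff] at hx
      rw [inner_rieszVec, inner_rieszVec]
      exact hmax x hx.1 hx.2)
  refine ⟨fun i => c (Sum.inl i), fun j => c (Sum.inr (Sum.inl j)) - c (Sum.inr (Sum.inr j)),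
    fun i => hc0 _, fun i => ?_, fun x => ?_⟩
  · by_cases h : G p i = b i
    · simp [h]
    · dsimp only
      rw [hca (Sum.inl i) fun hm => h (by
        simpa [systemNormal, systemRhs, inner_rieszVec] using (Finset.mem_filter.1 hm).2),
        zero_mul]
  · rw [← inner_rieszVec, ← hcs, sum_inner, Fintype.sum_sum_type, Fintype.sum_sum_type,
      dotProduct, dotProduct, ← Finset.sum_add_distrib]
    congr 1
    · exact Finset.sum_congr rfl fun i _ => by
        simp [systemNormal, inner_smul_left, inner_rieszVec]
    · refine Finset.sum_congr rfl fun i _ => ?_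
      simp only [systemNormal, inner_smul_left, inner_rieszVec, Sum.elim_inl, Sum.elim_inr,
        LinearMap.neg_apply, LinearMap.comp_apply, LinearMap.proj_apply]
      simp
      ring

end LinearSystem

/-! ### The constraint matrices -/

section Compact

variable {N m : ℕ} {mt : Fin N → ℕ}

theorem exists_vecUV (x : UV m mt → ℝ) : ∃ u V, x = vecUV (m := m) (mt := mt) u V :=
  ⟨fun i => x (Sum.inl i), fun t => Matrix.of fun i j => x (Sum.inr ⟨t, i, j⟩), by
    ext (i | ⟨t, i, j⟩) <;> rfl⟩

theorem exists_vecYZ (w : YIdx N m ⊕ ZIdx mt → ℝ) : ∃ y z, w = vecYZ (m := m) (mt := mt) y z :=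
  ⟨fun t i => w (Sum.inl (t, i)), fun t j => w (Sum.inr ⟨t, j⟩), by
    ext (⟨t, i⟩ | ⟨t, j⟩) <;> rfl⟩

theorem vecUV_dotProduct (u u' : Fin m → ℝ) (V V' : (t : Fin N) → Matrix (Fin m) (Fin (mt t)) ℝ) :
    vecUV u V ⬝ᵥ vecUV u' V' = u ⬝ᵥ u' + ∑ t, frob (V t) (V' t) := by
  simp only [dotProduct, vecUV, frob, Fintype.sum_sum_type, Sum.elim_inl, Sum.elim_inr,
    Fintype.sum_sigma, Fintype.sum_prod_type]

theorem vecYZ_dotProduct (y y' : Fin N → Fin m → ℝ) (z z' : (t : Fin N) → Fin (mt t) → ℝ) :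
    vecYZ y z ⬝ᵥ vecYZ y' z' = ∑ t, y t ⬝ᵥ y' t + ∑ t, z t ⬝ᵥ z' t := by
  simp only [dotProduct, vecYZ, Fintype.sum_sum_type, Sum.elim_inl, Sum.elim_inr,
    Fintype.sum_sigma, Fintype.sum_prod_type]

theorem matA_mulVec (u : Fin m → ℝ) (V : (t : Fin N) → Matrix (Fin m) (Fin (mt t)) ℝ) :
    matA m mt *ᵥ vecUV u V = vecUV (-u) V := by
  simp [matA, vecUV, Matrix.fromBlocks_mulVec, Matrix.neg_mulVec]

theorem matA_mul_self : matA m mt * matA m mt = 1 := by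
  simp [matA, Matrix.fromBlocks_multiply]

@[simp] theorem matB₁_inl (i : Fin m) (q : YIdx N m) :
    matB₁ m mt (Sum.inl i) q = if i = q.2 then 1 else 0 := rfl

@[simp] theorem matB₁_inr (r : (t : Fin N) × (Fin m × Fin (mt t))) (q : YIdx N m) :
    matB₁ m mt (Sum.inr r) q = if r.1 = q.1 then if r.2.1 = q.2 then -1 else 0 else 0 :=
  ite_and ..

@[simp] theorem matB₂_inl (i : Fin m) (q : ZIdx mt) : matB₂ m mt (Sum.inl i) q = 0 := rfl

@[simp] theorem matB₂_inr (r : (t : Fin N) × (Fin m × Fin (mt t))) (q : ZIdx mt) :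
    matB₂ m mt (Sum.inr r) q = if (⟨r.1, r.2.2⟩ : ZIdx mt) = q then -1 else 0 := rfl

@[simp] theorem matB_inl (r : UV m mt) (q : YIdx N m) :
    matB m mt r (Sum.inl q) = matB₁ m mt r q := rfl

@[simp] theorem matB_inr (r : UV m mt) (q : ZIdx mt) :
    matB m mt r (Sum.inr q) = matB₂ m mt r q := rfl

theorem matB_mulVec (y : Fin N → Fin m → ℝ) (z : (t : Fin N) → Fin (mt t) → ℝ) :
    matB m mt *ᵥ vecYZ y z = vecUV (∑ t, y t)
      (fun t => -Matrix.vecMulVec (y t) (fun _ => 1) - Matrix.vecMulVec (fun _ => 1) (z t)) := by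
  ext (i | ⟨t, i, j⟩)
  · simp [vecYZ, vecUV, Matrix.mulVec, dotProduct, Fintype.sum_prod_type]
  · simp [vecYZ, vecUV, Matrix.mulVec, dotProduct, Fintype.sum_prod_type, Matrix.vecMulVec_apply,
      sub_eq_add_neg]

theorem matB_transpose_mulVec (l : Fin m → ℝ) (L : (t : Fin N) → Matrix (Fin m) (Fin (mt t)) ℝ) :
    (matB m mt)ᵀ *ᵥ vecUV l L =
      vecYZ (fun t => l - L t *ᵥ fun _ => 1) (fun t => -((L t)ᵀ *ᵥ fun _ => 1)) := by
  ext (⟨t, i⟩ | ⟨t, j⟩)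
  · have h : ∑ s, ∑ i', ∑ j, (if s = t then if i' = i then -1 else 0 else 0) * L s i' j
        = -∑ j, L t i j := by
      rw [Finset.sum_eq_single t (fun s _ hs => by simp [hs]) (by simp)]
      simp [← Finset.sum_neg_distrib]
    have h' : ∑ i', (if i' = i then 1 else 0) * l i' = l i := by simp
    simp [vecYZ, vecUV, Matrix.mulVec, dotProduct, Fintype.sum_prod_type, Fintype.sum_sigma,
      sub_eq_add_neg, -ite_mul, h, h']
  · have h : ∑ s, ∑ i, ∑ j', (if (⟨s, j'⟩ : ZIdx mt) = ⟨t, j⟩ then -1 else 0) * L s i j'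
        = -∑ i, L t i j := by
      rw [Finset.sum_eq_single t (fun s _ hs => by simp [hs]) (by simp)]
      simp [← Finset.sum_neg_distrib]
    simp [vecYZ, vecUV, Matrix.mulVec, dotProduct, Fintype.sum_prod_type, Fintype.sum_sigma,
      -ite_mul, -Sigma.mk.injEq, h]

/-- The residuals of both constraints, `A [u; v] + B [y; z] - [0; vec D]`. -/
theorem vecUV_res (D V : (t : Fin N) → Matrix (Fin m) (Fin (mt t)) ℝ) (u : Fin m → ℝ)
    (y : Fin N → Fin m → ℝ) (z : (t : Fin N) → Fin (mt t) → ℝ) :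
    vecUV (res₁ u y) (res₂ D V y z) =
      matA m mt *ᵥ vecUV u V + matB m mt *ᵥ vecYZ y z - vecUV 0 D := by
  rw [matA_mulVec, matB_mulVec]
  ext (i | ⟨t, i, j⟩)
  · simp [vecUV, res₁]; ring
  · simp [vecUV, res₂]; ring

theorem matB₂_gram : (matB₂ m mt)ᵀ * matB₂ m mt = (m : ℝ) • 1 := by
  ext q ⟨t, j⟩
  simp only [Matrix.mul_apply, Matrix.transpose_apply, Fintype.sum_sum_type, matB₂_inl,
    matB₂_inr, mul_zero, Finset.sum_const_zero, zero_add, Fintype.sum_sigma,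
    Fintype.sum_prod_type, Matrix.smul_apply, Matrix.one_apply, smul_eq_mul]
  rw [Finset.sum_eq_single t (fun s _ hs => by simp [hs]) (by simp)]
  by_cases h : q = ⟨t, j⟩
  · simp [h]
  · simp [h, Ne.symm h]

variable (m mt) in
/-- The matrix `P` with `P [y; z] = B₂ᵀ B₁ y`, a factor of the Gauss–Seidel operator: `C` is a
multiple of `Pᵀ P`. -/
def matP : Matrix (ZIdx mt) (YIdx N m ⊕ ZIdx mt) ℝ :=
  Matrix.fromCols ((matB₂ m mt)ᵀ * matB₁ m mt) 0

/-- Since `B₂ᵀ B₂ = m I`, the Gauss–Seidel operator is `m⁻¹ Pᵀ P`. -/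
theorem matC_eq (hm : 0 < m) : matC m mt = (m : ℝ)⁻¹ • ((matP m mt)ᵀ * matP m mt) := by
  have hm' : (m : ℝ) ≠ 0 := by exact_mod_cast hm.ne'
  have hinv : ((m : ℝ) • (1 : Matrix (ZIdx mt) (ZIdx mt) ℝ))⁻¹ = (m : ℝ)⁻¹ • 1 :=
    Matrix.inv_eq_right_inv (by simp [smul_smul, hm'])
  rw [matC, matB₂_gram, matP, hinv, Matrix.transpose_fromCols, Matrix.fromRows_mul_fromCols,
    Matrix.fromBlocks_smul]
  simp [Matrix.mul_assoc]

end Compact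

/-! ### The weight matrix -/

section Weight

variable {N m : ℕ} {mt : Fin N → ℕ}

theorem dotProduct_transpose_mul_mulVec {ι κ : Type*} [Fintype ι] [Fintype κ]
    (S : Matrix κ ι ℝ) (x x' : ι → ℝ) : x ⬝ᵥ ((Sᵀ * S) *ᵥ x') = (S *ᵥ x) ⬝ᵥ (S *ᵥ x') := by
  rw [← Matrix.mulVec_mulVec, Matrix.dotProduct_mulVec, Matrix.vecMul_transpose]

theorem real_dotProduct_self_nonneg {ι : Type*} [Fintype ι] (x : ι → ℝ) : 0 ≤ x ⬝ᵥ x :=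
  Finset.sum_nonneg fun i _ => mul_self_nonneg (x i)

theorem matC_form (hm : 0 < m) (w w' : YIdx N m ⊕ ZIdx mt → ℝ) :
    w ⬝ᵥ (matC m mt *ᵥ w') = (m : ℝ)⁻¹ * ((matP m mt *ᵥ w) ⬝ᵥ (matP m mt *ᵥ w')) := by
  rw [matC_eq hm, Matrix.smul_mulVec, dotProduct_smul, dotProduct_transpose_mul_mulVec,
    smul_eq_mul]

theorem matC_form_comm (hm : 0 < m) (w w' : YIdx N m ⊕ ZIdx mt → ℝ) :
    w ⬝ᵥ (matC m mt *ᵥ w') = w' ⬝ᵥ (matC m mt *ᵥ w) := by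
  rw [matC_form hm, matC_form hm, dotProduct_comm]

theorem matC_form_nonneg (hm : 0 < m) (w : YIdx N m ⊕ ZIdx mt → ℝ) :
    0 ≤ w ⬝ᵥ (matC m mt *ᵥ w) := by
  rw [matC_form hm]
  exact mul_nonneg (by positivity) (real_dotProduct_self_nonneg _)

theorem wnorm_matC_sq (hm : 0 < m) (w : YIdx N m ⊕ ZIdx mt → ℝ) :
    wnorm (matC m mt) w ^ 2 = w ⬝ᵥ (matC m mt *ᵥ w) :=
  Real.sq_sqrt (matC_form_nonneg hm w)

/-- The quadratic form of `M`. -/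
theorem matM_form (β τ : ℝ) (x l : UV m mt → ℝ) (w : YIdx N m ⊕ ZIdx mt → ℝ) :
    Sum.elim x (Sum.elim w l) ⬝ᵥ (matM m mt β τ *ᵥ Sum.elim x (Sum.elim w l)) =
      β * (w ⬝ᵥ (matC m mt *ᵥ w)) + β * ((matB m mt *ᵥ w) ⬝ᵥ (matB m mt *ᵥ w)) +
      (τ * β)⁻¹ * (l ⬝ᵥ l) + sCoef τ * β *
        ((matA m mt *ᵥ x + matB m mt *ᵥ w) ⬝ᵥ (matA m mt *ᵥ x + matB m mt *ᵥ w)) := by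
  simp only [matM, Matrix.add_mulVec, Matrix.smul_mulVec, Matrix.fromBlocks_mulVec,
    Matrix.zero_mulVec, add_zero, zero_add, dotProduct_add, dotProduct_smul, add_dotProduct,
    Matrix.fromCols_mulVec, Matrix.fromRows_mulVec, Sum.elim_comp_inl, Sum.elim_comp_inr,
    sumElim_dotProduct_sumElim, Matrix.one_mulVec, dotProduct_zero, smul_eq_mul,
    ← Matrix.mulVec_mulVec, Matrix.dotProduct_mulVec _ (matA m mt)ᵀ,
    Matrix.dotProduct_mulVec _ (matB m mt)ᵀ, Matrix.vecMul_transpose]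
  ring

/-- `B` is not injective if `N > 1`, but the Gauss–Seidel term is definite on its kernel. -/
theorem eq_zero_of_matB_matP (hm : 0 < m) (hmt : ∀ t, 0 < mt t) (w : YIdx N m ⊕ ZIdx mt → ℝ)
    (hB : matB m mt *ᵥ w = 0) (hP : matP m mt *ᵥ w = 0) : w = 0 := by
  obtain ⟨y, z, rfl⟩ := exists_vecYZ w
  have hz' : vecYZ y z = Sum.elim (vecYZ y z ∘ Sum.inl) (vecYZ y z ∘ Sum.inr) := by simp
  have hz : ∀ q, vecYZ y z (Sum.inr q) = 0 := by
    have h1 := congrArg ((matB₂ m mt)ᵀ *ᵥ ·) hB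
    have hm' : (m : ℝ) ≠ 0 := by exact_mod_cast hm.ne'
    rw [matP, Matrix.fromCols_mulVec, Matrix.zero_mulVec, add_zero,
      ← Matrix.mulVec_mulVec] at hP
    simp only [matB, Matrix.fromCols_mulVec, Matrix.mulVec_add, hP, zero_add, Matrix.mulVec_mulVec,
      matB₂_gram, Matrix.smul_mulVec, Matrix.one_mulVec, Matrix.mulVec_zero] at h1
    intro q
    have h2 := congrFun h1 q
    simpa [hm'] using h2
  have hy : ∀ q, vecYZ y z (Sum.inl q) = 0 := by
    rintro ⟨t, i⟩
    have h1 := congrFun hB (Sum.inr ⟨t, i, ⟨0, hmt t⟩⟩)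
    have h2 := hz ⟨t, ⟨0, hmt t⟩⟩
    rw [matB_mulVec] at h1
    simp [vecUV, vecYZ, Matrix.vecMulVec_apply] at h1 h2 ⊢
    linarith
  ext (q | q)
  exacts [hy q, hz q]

/-- The coefficient `s_τ` lies strictly between `(1 - τ)²` and `2 - τ`. For `τ > 1` both differences
have the factor `1 + τ - τ²`, whose positive zero is the golden ratio. -/
theorem sCoef_bounds (τ : ℝ) (hτ₀ : 0 < τ) (hτ₁ : τ < (1 + Real.sqrt 5) / 2) :
    (1 - τ) ^ 2 < sCoef τ ∧ sCoef τ < 2 - τ := by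
  have h5 : Real.sqrt 5 ^ 2 = 5 := Real.sq_sqrt (by norm_num)
  have hq : 0 < 1 + τ - τ ^ 2 := by
    have h1 : 1 ≤ Real.sqrt 5 := Real.one_le_sqrt.2 (by norm_num)
    nlinarith [mul_pos (sub_pos.2 hτ₁) (by linarith : 0 < τ - (1 - Real.sqrt 5) / 2)]
  rw [sCoef]
  rcases le_or_gt τ 1 with h | h
  · rw [min_eq_left (h.trans ((one_le_inv₀ hτ₀).2 h))]
    constructor <;> nlinarith
  · rw [min_eq_right ((inv_le_one_of_one_le₀ h.le).trans h.le)]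
    have hi : τ * τ⁻¹ = 1 := mul_inv_cancel₀ hτ₀.ne'
    constructor
    · have : 0 < (1 + τ - τ ^ 2) * (4 * τ - 3) * τ⁻¹ :=
        mul_pos (mul_pos hq (by linarith)) (inv_pos.2 hτ₀)
      have e : (1 + τ - τ ^ 2) * (4 * τ - 3) * τ⁻¹ =
        (1 + 7 * τ - 4 * τ ^ 2) * (τ * τ⁻¹) - 3 * τ⁻¹ := by ring
      rw [hi] at e
      linarith
    · have : 0 < (1 + τ - τ ^ 2) * τ⁻¹ := mul_pos hq (inv_pos.2 hτ₀)
      have e : (1 + τ - τ ^ 2) * τ⁻¹ = τ⁻¹ + (1 - τ) * (τ * τ⁻¹) := by ring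
      rw [hi] at e
      linarith

theorem matM_posDef (hm : 0 < m) (hmt : ∀ t, 0 < mt t) (β τ : ℝ) (hβ : 0 < β) (hτ₀ : 0 < τ)
    (hτ₁ : τ < (1 + Real.sqrt 5) / 2) : (matM m mt β τ).PosDef := by
  rw [Matrix.posDef_iff_dotProduct_mulVec]
  refine ⟨?_, fun {ξ} hξ => ?_⟩
  · have hC : (matC m mt)ᵀ = matC m mt := by
      rw [matC_eq hm, Matrix.transpose_smul, Matrix.transpose_mul, Matrix.transpose_transpose]
    simp only [Matrix.IsHermitian, matM, Matrix.conjTranspose_eq_transpose_of_trivial,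
      Matrix.transpose_add, Matrix.transpose_smul, Matrix.fromBlocks_transpose,
      Matrix.transpose_zero, Matrix.transpose_fromCols, Matrix.transpose_fromRows,
      Matrix.transpose_mul, Matrix.transpose_transpose, Matrix.transpose_one, hC]
  obtain ⟨x, w, l, rfl⟩ : ∃ x w l, ξ = Sum.elim x (Sum.elim w l) :=
    ⟨ξ ∘ Sum.inl, ξ ∘ Sum.inr ∘ Sum.inl, ξ ∘ Sum.inr ∘ Sum.inr, by
      ext (i | i | i) <;> rfl⟩
  rw [star_trivial, matM_form]
  have hs : 0 < sCoef τ := (sq_nonneg _).trans_lt (sCoef_bounds τ hτ₀ hτ₁).1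
  have hC := matC_form hm w w
  have hP := real_dotProduct_self_nonneg (matP m mt *ᵥ w)
  have hB := real_dotProduct_self_nonneg (matB m mt *ᵥ w)
  have hl := real_dotProduct_self_nonneg l
  have hr := real_dotProduct_self_nonneg (matA m mt *ᵥ x + matB m mt *ᵥ w)
  have hm' : (0 : ℝ) < (m : ℝ)⁻¹ := by positivity
  rw [hC]
  by_contra! hle
  have p1 := mul_nonneg hβ.le (mul_nonneg hm'.le hP)
  have p2 := mul_nonneg hβ.le hB
  have p3 := mul_nonneg (inv_nonneg.2 (mul_pos hτ₀ hβ).le) hl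
  have p4 := mul_nonneg (mul_pos hs hβ).le hr
  have z1 : (matP m mt *ᵥ w) ⬝ᵥ (matP m mt *ᵥ w) = 0 := by
    have : β * ((m : ℝ)⁻¹ * ((matP m mt *ᵥ w) ⬝ᵥ (matP m mt *ᵥ w))) = 0 := by linarith
    simpa [hβ.ne', hm'.ne', show m ≠ 0 from hm.ne'] using this
  have z2 : (matB m mt *ᵥ w) ⬝ᵥ (matB m mt *ᵥ w) = 0 := by
    have : β * ((matB m mt *ᵥ w) ⬝ᵥ (matB m mt *ᵥ w)) = 0 := by linarith
    simpa [hβ.ne'] using this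
  have z3 : l ⬝ᵥ l = 0 := by
    have : (τ * β)⁻¹ * (l ⬝ᵥ l) = 0 := by linarith
    simpa [hβ.ne', hτ₀.ne'] using this
  have z4 : (matA m mt *ᵥ x + matB m mt *ᵥ w) ⬝ᵥ (matA m mt *ᵥ x + matB m mt *ᵥ w) = 0 := by
    have : sCoef τ * β *
      ((matA m mt *ᵥ x + matB m mt *ᵥ w) ⬝ᵥ (matA m mt *ᵥ x + matB m mt *ᵥ w)) = 0 := by linarith
    exact (mul_eq_zero.1 this).resolve_left (mul_pos hs hβ).ne'
  rw [dotProduct_self_eq_zero] at z1 z2 z3 z4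
  have hw := eq_zero_of_matB_matP hm hmt w z2 z1
  rw [z2, add_zero] at z4
  have hx : x = 0 := by
    have := congrArg (matA m mt *ᵥ ·) z4
    simpa [Matrix.mulVec_mulVec, matA_mul_self] using this
  refine hξ ?_
  rw [hx, hw, z3]
  ext (i | i | i) <;> rfl

end Weight

/-! ### The support function of the simplex -/

section Support

variable {m : ℕ}

/-- The largest coordinate of a vector, which is the value of the support function of the
simplex. -/
def maxCoord (u : Fin m → ℝ) : ℝ := ⨆ i, u i

theorem le_maxCoord (u : Fin m → ℝ) (i : Fin m) : u i ≤ maxCoord u :=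
  le_ciSup (Set.finite_range u).bddAbove i

theorem maxCoord_le (hm : 0 < m) {u : Fin m → ℝ} {c : ℝ} (h : ∀ i, u i ≤ c) : maxCoord u ≤ c :=
  have : Nonempty (Fin m) := ⟨⟨0, hm⟩⟩
  ciSup_le h

theorem maxCoord_zero : maxCoord (0 : Fin m → ℝ) = 0 := by
  simp [maxCoord]

theorem dotProduct_le_maxCoord {l : Fin m → ℝ} (hl : l ∈ stdSimplex ℝ (Fin m)) (u : Fin m → ℝ) :
    l ⬝ᵥ u ≤ maxCoord u := by
  calc l ⬝ᵥ u ≤ ∑ i, l i * maxCoord u :=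
        Finset.sum_le_sum fun i _ => mul_le_mul_of_nonneg_left (le_maxCoord u i) (hl.1 i)
    _ = maxCoord u := by rw [← Finset.sum_mul, hl.2, one_mul]

theorem maxCoord_convex (hm : 0 < m) (u u' : Fin m → ℝ) {t : ℝ} (h0 : 0 ≤ t) (h1 : t ≤ 1) :
    maxCoord (u + t • (u' - u)) ≤ maxCoord u + t * (maxCoord u' - maxCoord u) := by
  refine maxCoord_le hm fun i => ?_
  have e1 := mul_le_mul_of_nonneg_left (le_maxCoord u i) (sub_nonneg.2 h1)
  have e2 := mul_le_mul_of_nonneg_left (le_maxCoord u' i) h0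
  simp only [Pi.add_apply, Pi.smul_apply, Pi.sub_apply, smul_eq_mul]
  linarith

theorem simplexConj_eq (hm : 0 < m) (u : Fin m → ℝ) :
    simplexConj m u = ((maxCoord u : ℝ) : EReal) := by
  have : Nonempty (Fin m) := ⟨⟨0, hm⟩⟩
  refine le_antisymm (iSup_le fun x => ?_) ?_
  · by_cases hx : x ∈ stdSimplex ℝ (Fin m)
    · rw [indicatorFn, if_pos hx, sub_zero, EReal.coe_le_coe_iff, dotProduct_comm]
      exact dotProduct_le_maxCoord hx u
    · rw [indicatorFn, if_neg hx]
      simp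
  · obtain ⟨i, hi⟩ := exists_eq_ciSup_of_finite (f := u)
    refine le_iSup_of_le (Pi.single i 1) ?_
    rw [indicatorFn, if_pos (single_mem_stdSimplex ℝ i), sub_zero, EReal.coe_le_coe_iff, maxCoord,
      ← hi]
    simp

end Support

section Indicator

variable {N m : ℕ} {mt : Fin N → ℕ}

/-- All entries of all the matrices of the family are nonnegative. -/
def NonnegEntries (V : (t : Fin N) → Matrix (Fin m) (Fin (mt t)) ℝ) : Prop :=
  ∀ t i j, 0 ≤ V t i j

theorem nonnegInd_of_nonneg {p q : ℕ} {V : Matrix (Fin p) (Fin q) ℝ} (h : ∀ i j, 0 ≤ V i j) :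
    nonnegInd p q V = 0 := if_pos h

theorem nonnegInd_of_not {p q : ℕ} {V : Matrix (Fin p) (Fin q) ℝ} (h : ¬∀ i j, 0 ≤ V i j) :
    nonnegInd p q V = ⊤ := if_neg h

theorem nonnegInd_nonneg {p q : ℕ} (V : Matrix (Fin p) (Fin q) ℝ) : 0 ≤ nonnegInd p q V := by
  by_cases h : ∀ i j, 0 ≤ V i j
  · rw [nonnegInd_of_nonneg h]
  · rw [nonnegInd_of_not h]; exact le_top

theorem sum_nonnegInd_of_not {V : (t : Fin N) → Matrix (Fin m) (Fin (mt t)) ℝ}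
    (h : ¬NonnegEntries V) : ∑ t, nonnegInd m (mt t) (V t) = ⊤ := by
  rw [NonnegEntries, not_forall] at h
  obtain ⟨t, ht⟩ := h
  exact top_le_iff.1 ((nonnegInd_of_not ht).symm.le.trans
    (Finset.single_le_sum (f := fun t => nonnegInd m (mt t) (V t))
      (fun t _ => nonnegInd_nonneg (V t)) (Finset.mem_univ t)))

end Indicator

/-! ### One iteration of the algorithm -/

section Step

variable {N m : ℕ} {mt : Fin N → ℕ}

/-- The block `[u; v]`. -/
def Point.primal (W : Point m mt) : UV m mt → ℝ := vecUV W.u W.V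

/-- The block `[y; z]`. -/
def Point.free (W : Point m mt) : YIdx N m ⊕ ZIdx mt → ℝ := vecYZ W.y W.z

/-- The block `[λ; vec Λ]` of the multipliers. -/
def Point.mult (W : Point m mt) : UV m mt → ℝ := vecUV W.lam W.Lam

/-- The right-hand side `[0; vec D]` of the constraints. -/
def rhs (D : (t : Fin N) → Matrix (Fin m) (Fin (mt t)) ℝ) : UV m mt → ℝ := vecUV 0 D

/-- The linear objective `[0; a]` of the block `[y; z]`. -/
def cost (m : ℕ) {mt : Fin N → ℕ} (a : (t : Fin N) → Fin (mt t) → ℝ) :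
    YIdx N m ⊕ ZIdx mt → ℝ :=
  vecYZ 0 a

/-- The residual of the constraints, `A x + B w - [0; vec D]`. -/
def resid (D : (t : Fin N) → Matrix (Fin m) (Fin (mt t)) ℝ) (x : UV m mt → ℝ)
    (w : YIdx N m ⊕ ZIdx mt → ℝ) : UV m mt → ℝ :=
  matA m mt *ᵥ x + matB m mt *ᵥ w - rhs D

/-- The smooth part of the augmented Lagrangian. -/
def smoothLag (D : (t : Fin N) → Matrix (Fin m) (Fin (mt t)) ℝ) (a : (t : Fin N) → Fin (mt t) → ℝ)
    (β : ℝ) (x : UV m mt → ℝ) (w : YIdx N m ⊕ ZIdx mt → ℝ) (l : UV m mt → ℝ) : ℝ :=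
  cost m a ⬝ᵥ w + l ⬝ᵥ resid D x w + β / 2 * (resid D x w ⬝ᵥ resid D x w)

variable (D : (t : Fin N) → Matrix (Fin m) (Fin (mt t)) ℝ) (a : (t : Fin N) → Fin (mt t) → ℝ)

theorem augLag_of_nonneg (hm : 0 < m) (β : ℝ) (u : Fin m → ℝ)
    {V : (t : Fin N) → Matrix (Fin m) (Fin (mt t)) ℝ} (hV : NonnegEntries V)
    (y : Fin N → Fin m → ℝ) (z : (t : Fin N) → Fin (mt t) → ℝ) (lam : Fin m → ℝ)
    (Lam : (t : Fin N) → Matrix (Fin m) (Fin (mt t)) ℝ) :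
    augLag D a β u V y z lam Lam =
      ((maxCoord u + smoothLag D a β (vecUV u V) (vecYZ y z) (vecUV lam Lam) : ℝ) : EReal) := by
  rw [augLag, simplexConj_eq hm, Finset.sum_eq_zero fun t _ => nonnegInd_of_nonneg (hV t),
    add_zero, ← EReal.coe_add, smoothLag, resid, rhs, ← vecUV_res, vecUV_dotProduct,
    vecUV_dotProduct, cost, vecYZ_dotProduct]
  congr 2
  simp only [dotProduct_comm (a _), Pi.zero_apply, zero_dotProduct, Finset.sum_const_zero,
    zero_add]
  ring

theorem augLag_of_not (hm : 0 < m) (β : ℝ) (u : Fin m → ℝ)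
    {V : (t : Fin N) → Matrix (Fin m) (Fin (mt t)) ℝ} (hV : ¬NonnegEntries V)
    (y : Fin N → Fin m → ℝ) (z : (t : Fin N) → Fin (mt t) → ℝ) (lam : Fin m → ℝ)
    (Lam : (t : Fin N) → Matrix (Fin m) (Fin (mt t)) ℝ) :
    augLag D a β u V y z lam Lam = ⊤ := by
  rw [augLag, simplexConj_eq hm, sum_nonnegInd_of_not hV, EReal.coe_add_top, EReal.top_add_coe]

theorem smoothLag_add_free (β : ℝ) (x l : UV m mt → ℝ) (w h : YIdx N m ⊕ ZIdx mt → ℝ) (t : ℝ) :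
    smoothLag D a β x (w + t • h) l = smoothLag D a β x w l +
      (t * ((cost m a + (matB m mt)ᵀ *ᵥ (l + β • resid D x w)) ⬝ᵥ h) +
        t ^ 2 * (β / 2 * ((matB m mt *ᵥ h) ⬝ᵥ (matB m mt *ᵥ h)))) := by
  have hr : resid D x (w + t • h) = resid D x w + t • (matB m mt *ᵥ h) := by
    rw [resid, resid, Matrix.mulVec_add, Matrix.mulVec_smul]; abel
  simp only [smoothLag, hr, dotProduct_add, add_dotProduct, dotProduct_smul, smul_dotProduct,
    smul_eq_mul, Matrix.mulVec_transpose, ← Matrix.dotProduct_mulVec,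
    dotProduct_comm (matB m mt *ᵥ h) (resid D x w)]
  ring

theorem smoothLag_add_primal (β : ℝ) (x h l : UV m mt → ℝ) (w : YIdx N m ⊕ ZIdx mt → ℝ) (t : ℝ) :
    smoothLag D a β (x + t • h) w l = smoothLag D a β x w l +
      (t * ((l + β • resid D x w) ⬝ᵥ (matA m mt *ᵥ h)) +
        t ^ 2 * (β / 2 * ((matA m mt *ᵥ h) ⬝ᵥ (matA m mt *ᵥ h)))) := by
  have hr : resid D (x + t • h) w = resid D x w + t • (matA m mt *ᵥ h) := by
    rw [resid, resid, Matrix.mulVec_add, Matrix.mulVec_smul]; abel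
  simp only [smoothLag, hr, dotProduct_add, add_dotProduct, dotProduct_smul, smul_dotProduct,
    smul_eq_mul, dotProduct_comm (matA m mt *ᵥ h) (resid D x w)]
  ring

/-- The slope at `0` of a quadratic function that is nonnegative on `(0, 1]` is nonnegative. -/
theorem nonneg_of_forall_quadratic {α γ : ℝ}
    (h : ∀ t : ℝ, 0 < t → t ≤ 1 → 0 ≤ t * α + t ^ 2 * γ) : 0 ≤ α := by
  have hev : ∀ᶠ t : ℝ in nhdsWithin 0 (Set.Ioi 0), 0 ≤ α + t * γ := by
    filter_upwards [self_mem_nhdsWithin, nhdsWithin_le_nhds (Iic_mem_nhds one_pos)] with t h0 h1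
    have := h t h0 h1
    rw [show t * α + t ^ 2 * γ = t * (α + t * γ) by ring] at this
    exact nonneg_of_mul_nonneg_right this h0
  have hlim : Filter.Tendsto (fun t : ℝ => α + t * γ) (nhdsWithin 0 (Set.Ioi 0)) (nhds α) := by
    have : Continuous fun t : ℝ => α + t * γ := by fun_prop
    simpa using (this.tendsto 0).mono_left nhdsWithin_le_nhds
  exact ge_of_tendsto hlim hev

theorem eq_zero_of_forall_quadratic {α γ : ℝ} (h : ∀ t : ℝ, 0 ≤ t * α + t ^ 2 * γ) : α = 0 := by
  refine le_antisymm ?_ (nonneg_of_forall_quadratic fun t _ _ => h t)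
  have := nonneg_of_forall_quadratic (α := -α) (γ := γ) fun t _ _ => by
    have := h (-t)
    linarith [show -t * α + (-t) ^ 2 * γ = t * -α + t ^ 2 * γ by ring]
  linarith

/-- The first-order optimality conditions of one iteration from `W` to `W'`. The two Gauss–Seidel
sweeps over `z` and `y` amount to a joint minimisation over `[y; z]` with the additional proximal
term `β/2 ‖[y; z] - [yᵏ; zᵏ]‖_C²`. -/
structure StepConditions (β τ : ℝ) (W W' : Point m mt) : Prop where
  nonneg : NonnegEntries W'.V
  primal : ∀ u V, NonnegEntries V → 0 ≤ maxCoord u - maxCoord W'.u +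
    (W.mult + β • resid D W'.primal W.free) ⬝ᵥ (matA m mt *ᵥ (vecUV u V - W'.primal))
  free : cost m a + (matB m mt)ᵀ *ᵥ (W.mult + β • resid D W'.primal W'.free) +
    β • (matC m mt *ᵥ (W'.free - W.free)) = 0
  mult : W'.mult = W.mult + (τ * β) • resid D W'.primal W'.free

end Step

section StepProof

variable {N m : ℕ} {mt : Fin N → ℕ}
variable (D : (t : Fin N) → Matrix (Fin m) (Fin (mt t)) ℝ) (a : (t : Fin N) → Fin (mt t) → ℝ)

/-- The gradient of the smooth part of the augmented Lagrangian in `[y; z]`. -/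
def freeGrad (β : ℝ) (x : UV m mt → ℝ) (w : YIdx N m ⊕ ZIdx mt → ℝ) (l : UV m mt → ℝ) :
    YIdx N m ⊕ ZIdx mt → ℝ :=
  cost m a + (matB m mt)ᵀ *ᵥ (l + β • resid D x w)

theorem freeGrad_sub (β : ℝ) (x : UV m mt → ℝ) (w w' : YIdx N m ⊕ ZIdx mt → ℝ)
    (l : UV m mt → ℝ) : freeGrad D a β x w l - freeGrad D a β x w' l =
      β • ((matB m mt)ᵀ *ᵥ (matB m mt *ᵥ (w - w'))) := by
  simp only [freeGrad, resid, Matrix.mulVec_add, Matrix.mulVec_sub, Matrix.mulVec_smul, smul_sub,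
    smul_add]
  abel

variable {D a}

theorem freeGrad_dotProduct_eq_zero {β : ℝ} {x l : UV m mt → ℝ} {w h : YIdx N m ⊕ ZIdx mt → ℝ}
    (hmin : ∀ t : ℝ, smoothLag D a β x w l ≤ smoothLag D a β x (w + t • h) l) :
    freeGrad D a β x w l ⬝ᵥ h = 0 :=
  eq_zero_of_forall_quadratic fun t => by
    have := hmin t
    rw [smoothLag_add_free, le_add_iff_nonneg_right] at this
    exact this

theorem vecYZ_add_smul_right (y : Fin N → Fin m → ℝ) (z : (t : Fin N) → Fin (mt t) → ℝ)
    (h : ZIdx mt → ℝ) (t : ℝ) :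
    vecYZ y z + t • Sum.elim (0 : YIdx N m → ℝ) h = vecYZ y (fun s j => z s j + t * h ⟨s, j⟩) := by
  ext (q | q) <;> simp [vecYZ]

theorem vecYZ_add_smul_left (y : Fin N → Fin m → ℝ) (z : (t : Fin N) → Fin (mt t) → ℝ)
    (h : YIdx N m → ℝ) (t : ℝ) :
    vecYZ y z + t • Sum.elim h (0 : ZIdx mt → ℝ) = vecYZ (fun s i => y s i + t * h (s, i)) z := by
  ext (q | q) <;> simp [vecYZ]

/-- Stationarity after a minimisation over `z`. -/
theorem freeGrad_inr_eq_zero (hm : 0 < m) {β : ℝ} {u : Fin m → ℝ}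
    {V : (t : Fin N) → Matrix (Fin m) (Fin (mt t)) ℝ} (hV : NonnegEntries V)
    {y : Fin N → Fin m → ℝ} {z : (t : Fin N) → Fin (mt t) → ℝ} {lam : Fin m → ℝ}
    {Lam : (t : Fin N) → Matrix (Fin m) (Fin (mt t)) ℝ}
    (h : IsMinOn (fun z => augLag D a β u V y z lam Lam) Set.univ z) :
    freeGrad D a β (vecUV u V) (vecYZ y z) (vecUV lam Lam) ∘ Sum.inr = 0 := by
  rw [← dotProduct_eq_zero_iff]
  intro hz
  have := freeGrad_dotProduct_eq_zero (D := D) (a := a) (β := β) (x := vecUV u V)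
    (l := vecUV lam Lam) (w := vecYZ y z) (h := Sum.elim (0 : YIdx N m → ℝ) hz) fun t => by
      have := h (Set.mem_univ (fun s j => z s j + t * hz ⟨s, j⟩))
      simp only [Set.mem_ofPred_eq, augLag_of_nonneg D a hm β u hV, EReal.coe_le_coe_iff,
        ← vecYZ_add_smul_right] at this
      linarith
  rw [← Sum.elim_comp_inl_inr (freeGrad D a β _ _ _), sumElim_dotProduct_sumElim] at this
  simpa using this

/-- Stationarity after a minimisation over `y`. -/
theorem freeGrad_inl_eq_zero (hm : 0 < m) {β : ℝ} {u : Fin m → ℝ}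
    {V : (t : Fin N) → Matrix (Fin m) (Fin (mt t)) ℝ} (hV : NonnegEntries V)
    {y : Fin N → Fin m → ℝ} {z : (t : Fin N) → Fin (mt t) → ℝ} {lam : Fin m → ℝ}
    {Lam : (t : Fin N) → Matrix (Fin m) (Fin (mt t)) ℝ}
    (h : IsMinOn (fun y => augLag D a β u V y z lam Lam) Set.univ y) :
    freeGrad D a β (vecUV u V) (vecYZ y z) (vecUV lam Lam) ∘ Sum.inl = 0 := by
  rw [← dotProduct_eq_zero_iff]
  intro hy
  have := freeGrad_dotProduct_eq_zero (D := D) (a := a) (β := β) (x := vecUV u V)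
    (l := vecUV lam Lam) (w := vecYZ y z) (h := Sum.elim hy 0) fun t => by
      have := h (Set.mem_univ (fun s i => y s i + t * hy (s, i)))
      simp only [Set.mem_ofPred_eq, augLag_of_nonneg D a hm β u hV, EReal.coe_le_coe_iff,
        ← vecYZ_add_smul_left] at this
      linarith
  rw [← Sum.elim_comp_inl_inr (freeGrad D a β _ _ _), sumElim_dotProduct_sumElim] at this
  simpa using this

theorem IsStep.nonneg (hm : 0 < m) {β τ : ℝ} {W W' : Point m mt} (h : IsStep D a β τ W W') :
    NonnegEntries W'.V := by
  by_contra hV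
  have := h.1 (Set.mem_univ ((0 : Fin m → ℝ), fun t => (0 : Matrix (Fin m) (Fin (mt t)) ℝ)))
  simp only [Set.mem_ofPred_eq, augLag_of_not D a hm β _ hV,
    augLag_of_nonneg D a hm β 0 (V := fun t => (0 : Matrix (Fin m) (Fin (mt t)) ℝ))
      (fun t i j => le_rfl), top_le_iff] at this
  exact EReal.coe_ne_top _ this

/-- The variational inequality of the minimisation over `(u, V)`. -/
theorem IsStep.primal (hm : 0 < m) {β τ : ℝ} {W W' : Point m mt} (h : IsStep D a β τ W W')
    (u : Fin m → ℝ) (V : (t : Fin N) → Matrix (Fin m) (Fin (mt t)) ℝ) (hV : NonnegEntries V) :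
    0 ≤ maxCoord u - maxCoord W'.u +
      (W.mult + β • resid D W'.primal W.free) ⬝ᵥ (matA m mt *ᵥ (vecUV u V - W'.primal)) := by
  have hV' := h.nonneg hm
  refine nonneg_of_forall_quadratic
    (γ := β / 2 * ((matA m mt *ᵥ (vecUV u V - W'.primal)) ⬝ᵥ
      (matA m mt *ᵥ (vecUV u V - W'.primal)))) fun t h0 h1 => ?_
  have hVt : NonnegEntries fun s => W'.V s + t • (V s - W'.V s) := by
    intro s i j
    have e1 := mul_nonneg (sub_nonneg.2 h1) (hV' s i j)
    have e2 := mul_nonneg h0.le (hV s i j)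
    simp only [Matrix.add_apply, Matrix.smul_apply, Matrix.sub_apply, smul_eq_mul]
    linarith
  have hx : vecUV (W'.u + t • (u - W'.u)) (fun s => W'.V s + t • (V s - W'.V s)) =
      W'.primal + t • (vecUV u V - W'.primal) := by
    ext (i | ⟨s, i, j⟩) <;> simp [vecUV, Point.primal]
  have := h.1 (Set.mem_univ (W'.u + t • (u - W'.u), fun s => W'.V s + t • (V s - W'.V s)))
  simp only [Set.mem_ofPred_eq, augLag_of_nonneg D a hm β _ hV', augLag_of_nonneg D a hm β _ hVt,
    EReal.coe_le_coe_iff, hx, smoothLag_add_primal] at this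
  have hc := maxCoord_convex hm W'.u u h0.le h1
  simp only [Point.primal, Point.mult, Point.free] at this ⊢
  linarith

/-- Eliminating the auxiliary minimiser in `z` turns the Gauss–Seidel sweeps into a proximal step:
the gradient in `y` at the final `z` differs from the one at the auxiliary `z`, which vanishes, by
`-β C` times the increment. -/
theorem IsStep.free (hm : 0 < m) {β τ : ℝ} (hβ : 0 < β) {W W' : Point m mt}
    (h : IsStep D a β τ W W') :
    freeGrad D a β W'.primal W'.free W.mult + β • (matC m mt *ᵥ (W'.free - W.free)) = 0 := by
  have hV' := h.nonneg hm
  have hm' : (m : ℝ) ≠ 0 := by exact_mod_cast hm.ne'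
  obtain ⟨-, ⟨zt, hzt, hy⟩, hz, -⟩ := h
  have g1 := freeGrad_inr_eq_zero hm hV' hzt
  have g2 := freeGrad_inl_eq_zero hm hV' hy
  have g3 := freeGrad_inr_eq_zero hm hV' hz
  set Δ : YIdx N m → ℝ := fun q => W'.y q.1 q.2 - W.y q.1 q.2 with hΔ
  set δ : ZIdx mt → ℝ := fun q => W'.z q.1 q.2 - zt q.1 q.2 with hδ
  have d1 : vecYZ W'.y W'.z - vecYZ W.y zt = Sum.elim Δ δ := by
    ext (q | q) <;> simp [vecYZ, hΔ, hδ]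
  have d2 : vecYZ W'.y W'.z - vecYZ W'.y zt = Sum.elim (0 : YIdx N m → ℝ) δ := by
    ext (q | q) <;> simp [vecYZ, hδ]
  have hBt : ∀ r : UV m mt → ℝ, (matB m mt)ᵀ *ᵥ r =
      Sum.elim ((matB₁ m mt)ᵀ *ᵥ r) ((matB₂ m mt)ᵀ *ᵥ r) := fun r => by
    rw [matB, Matrix.transpose_fromCols, Matrix.fromRows_mulVec]
  have hB : ∀ f g, matB m mt *ᵥ Sum.elim f g = matB₁ m mt *ᵥ f + matB₂ m mt *ᵥ g := fun f g => by
    rw [matB, Matrix.fromCols_mulVec]; simp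
  -- the two minimisations over `z` determine the correction `δ` of `z` in terms of `Δ`
  have hδΔ : δ = -((m : ℝ)⁻¹ • ((matB₂ m mt)ᵀ *ᵥ (matB₁ m mt *ᵥ Δ))) := by
    have e := congrArg (· ∘ Sum.inr) (freeGrad_sub D a β (vecUV W'.u W'.V) (vecYZ W'.y W'.z)
      (vecYZ W.y zt) (vecUV W.lam W.Lam))
    simp only [d1, hB, hBt, Pi.sub_comp, g1, g3, sub_zero, Pi.smul_comp, Sum.elim_comp_inr,
      Matrix.mulVec_add, Matrix.mulVec_mulVec _ _ (matB₂ m mt), matB₂_gram, Matrix.smul_mulVec,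
      Matrix.one_mulVec] at e
    have e2 := (smul_eq_zero.1 e.symm).resolve_left hβ.ne'
    have e3 : (m : ℝ) • δ = -((matB₂ m mt)ᵀ *ᵥ (matB₁ m mt *ᵥ Δ)) := by
      rw [eq_neg_iff_add_eq_zero, add_comm]
      simpa only [Matrix.mulVec_mulVec] using e2
    rw [← smul_neg, ← e3, smul_smul, inv_mul_cancel₀ hm', one_smul]
  have hC : matC m mt *ᵥ (W'.free - W.free) =
      Sum.elim (-((matB₁ m mt)ᵀ *ᵥ (matB₂ m mt *ᵥ δ))) 0 := by
    have hP : matP m mt *ᵥ (W'.free - W.free) = (matB₂ m mt)ᵀ *ᵥ (matB₁ m mt *ᵥ Δ) := by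
      rw [matP, Matrix.fromCols_mulVec, Matrix.zero_mulVec, add_zero, Matrix.mulVec_mulVec]
      rfl
    rw [matC_eq hm, Matrix.smul_mulVec, ← Matrix.mulVec_mulVec, hP, hδΔ, matP,
      Matrix.transpose_fromCols, Matrix.fromRows_mulVec]
    ext (q | q)
    · simp [Matrix.mulVec_neg, Matrix.mulVec_smul, Matrix.mulVec_mulVec, Matrix.mul_assoc]
    · simp
  have e := freeGrad_sub D a β (vecUV W'.u W'.V) (vecYZ W'.y W'.z)
      (vecYZ W'.y zt) (vecUV W.lam W.Lam)
  rw [d2, hB, hBt, Matrix.mulVec_zero, zero_add] at e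
  rw [hC]
  ext (q | q)
  · have e1 := congrFun e (Sum.inl q)
    have e2 := congrFun g2 q
    simp only [Pi.sub_apply, Function.comp_apply, Pi.zero_apply] at e1 e2
    rw [e2, sub_zero] at e1
    simp only [Pi.add_apply, Point.primal, Point.free, Point.mult, e1]
    simp
  · simpa [Point.primal, Point.free, Point.mult] using congrFun g3 q

theorem IsStep.conditions (hm : 0 < m) {β τ : ℝ} (hβ : 0 < β) {W W' : Point m mt}
    (h : IsStep D a β τ W W') : StepConditions D a β τ W W' where
  nonneg := h.nonneg hm
  primal := h.primal hm
  free := h.free hm hβ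
  mult := by
    obtain ⟨-, -, -, h1, h2⟩ := h
    rw [resid, rhs, Point.primal, Point.free, ← vecUV_res, Point.mult, Point.mult, h1]
    ext (i | ⟨t, i, j⟩)
    · simp [vecUV]
    · simp [vecUV, h2]

end StepProof

/-! ### Decrease of the energy -/

section Energy

variable {N m : ℕ} {mt : Fin N → ℕ}
variable {D : (t : Fin N) → Matrix (Fin m) (Fin (mt t)) ℝ} {a : (t : Fin N) → Fin (mt t) → ℝ}

theorem frob_sub {p q : ℕ} (X Y Z : Matrix (Fin p) (Fin q) ℝ) :
    frob X (Y - Z) = frob X Y - frob X Z := by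
  simp [frob, mul_sub, Finset.sum_sub_distrib]

theorem frob_neg {p q : ℕ} (X Y : Matrix (Fin p) (Fin q) ℝ) : frob (-X) Y = -frob X Y := by
  simp [frob]

theorem IsKKT.nonneg {W : Point m mt} (h : IsKKT D a W) : NonnegEntries W.V := by
  intro t
  by_contra hV
  have := (h.stat_V t).1
  rw [nonnegInd_of_not hV] at this
  exact lt_irrefl _ this

/-- The inclusions of `λ` and `-Λ` in the subdifferentials, as one variational inequality. -/
theorem IsKKT.primal (hm : 0 < m) {W : Point m mt} (h : IsKKT D a W)
    (u : Fin m → ℝ) (V : (t : Fin N) → Matrix (Fin m) (Fin (mt t)) ℝ) (hV : NonnegEntries V) :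
    0 ≤ maxCoord u - maxCoord W.u + W.mult ⬝ᵥ (matA m mt *ᵥ (vecUV u V - W.primal)) := by
  have h1 := h.stat_u.2 u
  rw [simplexConj_eq hm, simplexConj_eq hm, ← EReal.coe_add, EReal.coe_le_coe_iff] at h1
  simp only [dotProduct_sub] at h1
  have h2 : 0 ≤ ∑ t, (frob (W.Lam t) (V t) - frob (W.Lam t) (W.V t)) :=
    Finset.sum_nonneg fun t _ => by
      have := (h.stat_V t).2 (V t)
      rw [nonnegInd_of_nonneg (h.nonneg t), nonnegInd_of_nonneg (hV t), zero_add, frob_neg,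
        frob_sub] at this
      have : -(frob (W.Lam t) (V t) - frob (W.Lam t) (W.V t)) ≤ 0 := by exact_mod_cast this
      linarith
  rw [Finset.sum_sub_distrib] at h2
  rw [Matrix.mulVec_sub, dotProduct_sub, Point.primal, Point.mult, matA_mulVec, matA_mulVec,
    vecUV_dotProduct, vecUV_dotProduct, dotProduct_neg, dotProduct_neg]
  linarith

theorem IsKKT.free {W : Point m mt} (h : IsKKT D a W) :
    cost m a + (matB m mt)ᵀ *ᵥ W.mult = 0 := by
  rw [Point.mult, matB_transpose_mulVec, cost]
  ext (⟨t, i⟩ | ⟨t, j⟩)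
  · simp [vecYZ, h.stat_y t]
  · simp [vecYZ, h.stat_z t]

theorem IsKKT.resid {W : Point m mt} (h : IsKKT D a W) : resid D W.primal W.free = 0 := by
  rw [WassersteinBarycenter.resid, rhs, Point.primal, Point.free, ← vecUV_res, h.feas₁]
  ext (i | ⟨t, i, j⟩)
  · rfl
  · simp [vecUV, h.feas₂ t]

/-- The quantity `‖Δ‖_C² + ‖B Δ‖² + ‖r‖²` that measures the progress of an iteration, where `Δ` is
the increment of `[y; z]` and `r` the new residual. -/
def progress (Δ : YIdx N m ⊕ ZIdx mt → ℝ) (r : UV m mt → ℝ) : ℝ :=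
  Δ ⬝ᵥ (matC m mt *ᵥ Δ) + (matB m mt *ᵥ Δ) ⬝ᵥ (matB m mt *ᵥ Δ) + r ⬝ᵥ r

theorem progress_nonneg (hm : 0 < m) (Δ : YIdx N m ⊕ ZIdx mt → ℝ) (r : UV m mt → ℝ) :
    0 ≤ progress Δ r :=
  add_nonneg (add_nonneg (matC_form_nonneg hm _) (real_dotProduct_self_nonneg _))
    (real_dotProduct_self_nonneg _)

/-- `‖𝒲 - 𝒲'‖_M²`. -/
def sqDistM (β τ : ℝ) (W W' : Point m mt) : ℝ :=
  (W.vec - W'.vec) ⬝ᵥ (matM m mt β τ *ᵥ (W.vec - W'.vec))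

theorem vec_sub (W W' : Point m mt) : W.vec - W'.vec =
    Sum.elim (W.primal - W'.primal) (Sum.elim (W.free - W'.free) (W.mult - W'.mult)) := by
  ext (i | i | i) <;> simp [Point.vec, Point.primal, Point.free, Point.mult]

theorem resid_sub (x x' : UV m mt → ℝ) (w w' : YIdx N m ⊕ ZIdx mt → ℝ) :
    matA m mt *ᵥ (x - x') + matB m mt *ᵥ (w - w') = resid D x w - resid D x' w' := by
  rw [resid, resid, Matrix.mulVec_sub, Matrix.mulVec_sub]
  abel

/-- The constant in the energy decrease, positive for `τ < (1 + √5) / 2`. -/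
def decreaseConst (τ : ℝ) : ℝ := min 1 (min (2 - τ - sCoef τ) (1 - (1 - τ) ^ 2 / sCoef τ))

theorem decreaseConst_pos (τ : ℝ) (hτ₀ : 0 < τ) (hτ₁ : τ < (1 + Real.sqrt 5) / 2) :
    0 < decreaseConst τ := by
  obtain ⟨h1, h2⟩ := sCoef_bounds τ hτ₀ hτ₁
  have hs : 0 < sCoef τ := (sq_nonneg _).trans_lt h1
  refine lt_min one_pos (lt_min (by linarith) ?_)
  rw [sub_pos, div_lt_one hs]
  exact h1

/-- The energy `‖𝒲 - 𝒲*‖_M² + β ‖Δ‖_C²` relative to a KKT point `𝒲*` decreases by a multiple of the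
progress. Monotonicity of the subdifferential controls `⟨B Δ, r⟩`, and comparing the optimality
conditions of two consecutive iterations turns this term into `(1 - τ) ⟨B Δ, r⁻⟩` plus
differences of `‖Δ‖_C²`. The part `s_τ β ‖r‖²` of the `M`-norm then absorbs it, because
`(1 - τ)² < s_τ < 2 - τ`. -/
theorem energy_decrease (hm : 0 < m) {β τ : ℝ} (hβ : 0 < β) (hτ₀ : 0 < τ)
    (hτ₁ : τ < (1 + Real.sqrt 5) / 2) {W₀ W₁ W₂ Ws : Point m mt}
    (h₁ : StepConditions D a β τ W₀ W₁) (h₂ : StepConditions D a β τ W₁ W₂) (hs : IsKKT D a Ws) :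
    sqDistM β τ W₂ Ws + β * ((W₂.free - W₁.free) ⬝ᵥ (matC m mt *ᵥ (W₂.free - W₁.free))) +
      decreaseConst τ * β * progress (W₂.free - W₁.free) (resid D W₂.primal W₂.free) ≤
    sqDistM β τ W₁ Ws + β * ((W₁.free - W₀.free) ⬝ᵥ (matC m mt *ᵥ (W₁.free - W₀.free))) := by
  obtain ⟨hs1, hs2⟩ := sCoef_bounds τ hτ₀ hτ₁
  have hspos : 0 < sCoef τ := (sq_nonneg _).trans_lt hs1
  set r := resid D W₂.primal W₂.free with hr
  set r' := resid D W₁.primal W₁.free with hr'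
  set Δ := W₂.free - W₁.free with hΔ
  set Δ' := W₁.free - W₀.free with hΔ'
  set e := W₂.free - Ws.free with he
  set l := W₁.mult - Ws.mult with hl
  have f1 : W₁.free - Ws.free = e - Δ := by rw [he, hΔ]; abel
  have f2 : W₂.mult - Ws.mult = l + (τ * β) • r := by rw [hl, h₂.mult]; abel
  have f3 : resid D W₂.primal W₁.free = r - matB m mt *ᵥ Δ := by
    rw [hr, hΔ, resid, resid, Matrix.mulVec_sub]; abel
  have f4 : matA m mt *ᵥ (Ws.primal - W₂.primal) = matB m mt *ᵥ e - r := by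
    have := resid_sub (D := D) Ws.primal W₂.primal Ws.free W₂.free
    rw [hs.resid, ← hr] at this
    rw [he, eq_sub_iff_add_eq.2 this, Matrix.mulVec_sub, Matrix.mulVec_sub]; abel
  -- monotonicity of the subdifferential, between `W₂` and `Ws`
  have m1 : 0 ≤ (l + β • r - β • (matB m mt *ᵥ Δ)) ⬝ᵥ (matB m mt *ᵥ e - r) := by
    have e1 := h₂.primal Ws.u Ws.V hs.nonneg
    have e2 := hs.primal hm W₂.u W₂.V h₂.nonneg
    change 0 ≤ _ + _ ⬝ᵥ (matA m mt *ᵥ (Ws.primal - W₂.primal)) at e1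
    change 0 ≤ _ + _ ⬝ᵥ (matA m mt *ᵥ (W₂.primal - Ws.primal)) at e2
    rw [← neg_sub Ws.primal, Matrix.mulVec_neg, dotProduct_neg, f4] at e2
    rw [f3, f4] at e1
    have : (l + β • r - β • (matB m mt *ᵥ Δ)) =
      (W₁.mult + β • (r - matB m mt *ᵥ Δ)) - Ws.mult := by rw [hl, smul_sub]; abel
    rw [this, sub_dotProduct]
    linarith
  -- the optimality condition for `[y; z]` at `W₂`, compared with that at `Ws`
  have m2 : (l + β • r) ⬝ᵥ (matB m mt *ᵥ e) + β * (e ⬝ᵥ (matC m mt *ᵥ Δ)) = 0 := by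
    have e1 := congrArg (e ⬝ᵥ ·) (congrArg₂ (· - ·) h₂.free hs.free)
    have : cost m a + (matB m mt)ᵀ *ᵥ (W₁.mult + β • r) + β • (matC m mt *ᵥ Δ) -
        (cost m a + (matB m mt)ᵀ *ᵥ Ws.mult) =
        (matB m mt)ᵀ *ᵥ (l + β • r) + β • (matC m mt *ᵥ Δ) := by
      simp only [hl, Matrix.mulVec_add, Matrix.mulVec_sub]; abel
    simp only [← hr, ← hΔ, this, dotProduct_add, sub_zero, dotProduct_zero, dotProduct_smul,
      smul_eq_mul, Matrix.dotProduct_mulVec _ (matB m mt)ᵀ, Matrix.vecMul_transpose] at e1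
    rw [dotProduct_comm, dotProduct_add, dotProduct_smul, smul_eq_mul, e1]
  -- the same condition at `W₂`, compared with that at `W₁`
  have m3 : (β • r - (β * (1 - τ)) • r') ⬝ᵥ (matB m mt *ᵥ Δ) +
      β * (Δ ⬝ᵥ (matC m mt *ᵥ Δ) - Δ ⬝ᵥ (matC m mt *ᵥ Δ')) = 0 := by
    have e1 := congrArg (Δ ⬝ᵥ ·) (congrArg₂ (· - ·) h₂.free h₁.free)
    have : cost m a + (matB m mt)ᵀ *ᵥ (W₁.mult + β • r) + β • (matC m mt *ᵥ Δ) -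
        (cost m a + (matB m mt)ᵀ *ᵥ (W₀.mult + β • r') + β • (matC m mt *ᵥ Δ')) =
        (matB m mt)ᵀ *ᵥ (β • r - (β * (1 - τ)) • r') +
          (β • (matC m mt *ᵥ Δ) - β • (matC m mt *ᵥ Δ')) := by
      have : W₁.mult + β • r = W₀.mult + β • r' + (β • r - (β * (1 - τ)) • r') := by
        rw [h₁.mult, ← hr', mul_sub, mul_one, sub_smul, mul_comm β τ]; abel
      rw [this, Matrix.mulVec_add _ (W₀.mult + β • r')]; abel
    simp only [← hr, ← hΔ, ← hr', ← hΔ', this, dotProduct_add, dotProduct_sub, sub_zero,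
      dotProduct_zero, dotProduct_smul, smul_eq_mul, Matrix.dotProduct_mulVec _ (matB m mt)ᵀ,
      Matrix.vecMul_transpose] at e1
    rw [dotProduct_comm, dotProduct_sub, dotProduct_smul, dotProduct_smul, smul_eq_mul, smul_eq_mul]
    linarith
  have m4 := matC_form_nonneg hm (Δ - Δ')
  have m5 := real_dotProduct_self_nonneg ((1 - τ) • (matB m mt *ᵥ Δ) - sCoef τ • r')
  rw [sqDistM, sqDistM, vec_sub, vec_sub, matM_form, matM_form, resid_sub (D := D),
    resid_sub (D := D), hs.resid, f1, f2, ← hr, ← hr', ← he, ← hl, progress]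
  have hCs := matC_form_comm (mt := mt) hm
  simp only [Matrix.mulVec_sub, dotProduct_sub, sub_dotProduct, dotProduct_add, add_dotProduct,
    dotProduct_smul, smul_dotProduct, smul_eq_mul, sub_zero] at m1 m2 m3 m4 m5 ⊢
  rw [hCs Δ e, dotProduct_comm (matB m mt *ᵥ Δ) (matB m mt *ᵥ e), dotProduct_comm r l]
  rw [hCs Δ' Δ] at m4
  rw [dotProduct_comm (matB m mt *ᵥ Δ) (matB m mt *ᵥ e), dotProduct_comm (matB m mt *ᵥ Δ) r] at m1
  rw [dotProduct_comm r'] at m5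
  rw [dotProduct_comm r'] at m3
  have g1 : decreaseConst τ ≤ 1 := min_le_left _ _
  have g2 : decreaseConst τ ≤ 2 - τ - sCoef τ := (min_le_right _ _).trans (min_le_left _ _)
  have g3 : decreaseConst τ ≤ 1 - (1 - τ) ^ 2 / sCoef τ :=
    (min_le_right _ _).trans (min_le_right _ _)
  have p1 := mul_le_mul_of_nonneg_right g1 (matC_form_nonneg hm Δ)
  have p2 := mul_le_mul_of_nonneg_right g2 (real_dotProduct_self_nonneg r)
  have p3 := mul_le_mul_of_nonneg_right g3 (real_dotProduct_self_nonneg (matB m mt *ᵥ Δ))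
  set ll := l ⬝ᵥ l
  set lr := l ⬝ᵥ r
  set rr := r ⬝ᵥ r
  set bb := (matB m mt *ᵥ Δ) ⬝ᵥ (matB m mt *ᵥ Δ)
  set brm := (matB m mt *ᵥ Δ) ⬝ᵥ r'
  set rmrm := r' ⬝ᵥ r'
  have m6 : 0 ≤ (1 - τ) ^ 2 / sCoef τ * bb - 2 * (1 - τ) * brm + sCoef τ * rmrm := by
    refine (div_nonneg m5 hspos.le).trans_eq ?_
    field_simp
    ring
  have hinv : (τ * β)⁻¹ * (ll + τ * β * lr + τ * β * (lr + τ * β * rr)) =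
      (τ * β)⁻¹ * ll + 2 * lr + τ * β * rr := by
    field_simp
    ring
  rw [hinv]
  linear_combination 2 * m1 + 2 * m2 + 2 * m3 + β * m4 + β * m6 + β * p1 + β * p2 + β * p3

end Energy

/-! ### The KKT system as a system of linear inequalities -/

section System

variable {N m : ℕ} {mt : Fin N → ℕ}
variable (D : (t : Fin N) → Matrix (Fin m) (Fin (mt t)) ℝ) (a : (t : Fin N) → Fin (mt t) → ℝ)

/-- Coordinates of the family of matrices `V`. -/
abbrev VIdx (m : ℕ) {N : ℕ} (mt : Fin N → ℕ) : Type := (t : Fin N) × (Fin m × Fin (mt t))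

/-- Triples of the blocks `[u; v]`, `[y; z]`, `[λ; vec Λ]`. -/
abbrev Blocks (m : ℕ) {N : ℕ} (mt : Fin N → ℕ) : Type :=
  (UV m mt → ℝ) × (YIdx N m ⊕ ZIdx mt → ℝ) × (UV m mt → ℝ)

/-- The left-hand sides of the inequalities `-V ≤ 0`, `-Λ ≤ 0` and
`uᵢ + ⟨[0; a], [y; z]⟩ + ⟨[0; vec D], [λ; vec Λ]⟩ ≤ 0`. The last ones say that the duality gap, with
`δ*_Δ(u)` written as a maximum of coordinates, is nonpositive; they replace complementarity by
linear conditions. -/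
def kktIneq : Blocks m mt →ₗ[ℝ] (VIdx m mt ⊕ (VIdx m mt ⊕ Fin m) → ℝ) where
  toFun p := Sum.elim (fun r => -p.1 (Sum.inr r)) (Sum.elim (fun r => -p.2.2 (Sum.inr r))
    (fun i => p.1 (Sum.inl i) + cost m a ⬝ᵥ p.2.1 + rhs D ⬝ᵥ p.2.2))
  map_add' p q := by
    ext (r | r | i)
    · simp [add_comm]
    · simp [add_comm]
    · simp; ring
  map_smul' c p := by
    ext (r | r | i)
    · simp
    · simp
    · simp; ring

/-- The left-hand sides of the equations `A x + B w = [0; vec D]` and `Bᵀ l = -[0; a]`. -/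
def kktEq (m : ℕ) {N : ℕ} (mt : Fin N → ℕ) :
    Blocks m mt →ₗ[ℝ] (UV m mt ⊕ (YIdx N m ⊕ ZIdx mt) → ℝ) where
  toFun p := Sum.elim (matA m mt *ᵥ p.1 + matB m mt *ᵥ p.2.1) ((matB m mt)ᵀ *ᵥ p.2.2)
  map_add' p q := by
    ext (r | r)
    · simp [Matrix.mulVec_add]; ring
    · simp [Matrix.mulVec_add]
  map_smul' c p := by
    ext (r | r)
    · simp [Matrix.mulVec_smul]; ring
    · simp [Matrix.mulVec_smul]

/-- The right-hand sides that belong to `kktEq`. -/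
def kktRhs : UV m mt ⊕ (YIdx N m ⊕ ZIdx mt) → ℝ := Sum.elim (rhs D) (-cost m a)

variable {D a}

theorem frob_nonneg {p q : ℕ} {X Y : Matrix (Fin p) (Fin q) ℝ} (hX : ∀ i j, 0 ≤ X i j)
    (hY : ∀ i j, 0 ≤ Y i j) : 0 ≤ frob X Y :=
  Finset.sum_nonneg fun i _ => Finset.sum_nonneg fun j _ => mul_nonneg (hX i j) (hY i j)

/-- Solutions of the linear system are KKT points: the gap splits into the nonnegative parts
`δ*_Δ(u) - ⟨λ, u⟩` and `⟨Λ⁽ᵗ⁾, V⁽ᵗ⁾⟩`, which therefore vanish. -/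
theorem exists_isKKT_of_system (hN : 0 < N) (hm : 0 < m)
    (ha : ∀ t, a t ∈ stdSimplex ℝ (Fin (mt t))) (p : Blocks m mt)
    (hG : ∀ i, kktIneq D a p i ≤ 0) (hH : kktEq m mt p = kktRhs D a) :
    ∃ W : Point m mt, IsKKT D a W ∧ W.primal = p.1 ∧ W.free = p.2.1 ∧ W.mult = p.2.2 := by
  obtain ⟨x, w, l⟩ := p
  obtain ⟨u, V, rfl⟩ := exists_vecUV x
  obtain ⟨y, z, rfl⟩ := exists_vecYZ w
  obtain ⟨lam, Lam, rfl⟩ := exists_vecUV l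
  refine ⟨⟨u, V, y, z, lam, Lam⟩, ?_, rfl, rfl, rfl⟩
  have hV : NonnegEntries V := fun t i j => by
    simpa [kktIneq, vecUV] using hG (Sum.inl ⟨t, i, j⟩)
  have hL : NonnegEntries Lam := fun t i j => by
    simpa [kktIneq, vecUV] using hG (Sum.inr (Sum.inl ⟨t, i, j⟩))
  have hfeas : matA m mt *ᵥ vecUV u V + matB m mt *ᵥ vecYZ y z = rhs D := by
    ext i; exact congrFun hH (Sum.inl i)
  have hdual : (matB m mt)ᵀ *ᵥ vecUV lam Lam = -cost m a := by
    ext i; exact congrFun hH (Sum.inr i)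
  have hy : ∀ t, Lam t *ᵥ (fun _ => 1) = lam := fun t => by
    ext i
    have := congrFun hdual (Sum.inl (t, i))
    rw [matB_transpose_mulVec] at this
    simp only [vecYZ, cost, Sum.elim_inl, Pi.sub_apply, Pi.neg_apply, Pi.zero_apply, neg_zero]
      at this
    linarith
  have hz : ∀ t, (Lam t)ᵀ *ᵥ (fun _ => 1) = a t := fun t => by
    ext j
    have := congrFun hdual (Sum.inr ⟨t, j⟩)
    rw [matB_transpose_mulVec] at this
    simpa only [vecYZ, cost, Sum.elim_inr, Pi.neg_apply, neg_inj] using this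
  have hres := vecUV_res D V u y z
  have hres0 : matA m mt *ᵥ vecUV u V + matB m mt *ᵥ vecYZ y z - vecUV 0 D = 0 :=
    sub_eq_zero.2 hfeas
  rw [hres0] at hres
  have hlam : lam ∈ stdSimplex ℝ (Fin m) := by
    have t : Fin N := ⟨0, hN⟩
    have hrow : ∀ i, lam i = ∑ j, Lam t i j := fun i => by
      simp [← hy t, Matrix.mulVec, dotProduct]
    have hcol : ∀ j, a t j = ∑ i, Lam t i j := fun j => by
      simp [← hz t, Matrix.mulVec, dotProduct]
    refine ⟨fun i => ?_, ?_⟩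
    · rw [hrow]
      exact Finset.sum_nonneg fun j _ => hL t i j
    · rw [← (ha t).2, Finset.sum_congr rfl fun i _ => hrow i,
        Finset.sum_congr rfl fun j _ => hcol j]
      exact Finset.sum_comm
  have hgap : maxCoord u - lam ⬝ᵥ u + ∑ t, frob (Lam t) (V t) ≤ 0 := by
    have h1 : maxCoord u ≤ -(cost m a ⬝ᵥ vecYZ y z + rhs D ⬝ᵥ vecUV lam Lam) :=
      maxCoord_le hm fun i => by
        have := hG (Sum.inr (Sum.inr i))
        simp only [kktIneq, LinearMap.coe_mk, AddHom.coe_mk, Sum.elim_inr, vecUV, Sum.elim_inl]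
          at this
        simp only [vecUV]
        linarith
    rw [← hfeas, ← neg_neg (cost m a), ← hdual, neg_dotProduct, add_dotProduct,
      Matrix.mulVec_transpose, ← Matrix.dotProduct_mulVec, dotProduct_comm _ (vecUV lam Lam),
      dotProduct_comm _ (vecUV lam Lam), matA_mulVec, vecUV_dotProduct, dotProduct_neg] at h1
    linarith
  have hgu := dotProduct_le_maxCoord hlam u
  have hgV : ∀ t, 0 ≤ frob (Lam t) (V t) := fun t => frob_nonneg (hL t) (hV t)
  have hgV' := Finset.sum_nonneg fun t (_ : t ∈ Finset.univ) => hgV t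
  have hcompl : ∀ t, frob (Lam t) (V t) = 0 := fun t =>
    (Finset.sum_eq_zero_iff_of_nonneg fun t _ => hgV t).1 (by linarith) t (Finset.mem_univ t)
  exact
    { stat_u := by
        refine ⟨by rw [simplexConj_eq hm]; exact EReal.coe_lt_top _, fun u' => ?_⟩
        rw [simplexConj_eq hm, simplexConj_eq hm, ← EReal.coe_add, EReal.coe_le_coe_iff]
        have := dotProduct_le_maxCoord hlam u'
        simp only [dotProduct_sub]
        linarith
      stat_V := fun t => by
        refine ⟨by rw [nonnegInd_of_nonneg (hV t)]; exact EReal.zero_lt_top, fun V' => ?_⟩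
        by_cases hV' : ∀ i j, 0 ≤ V' i j
        · rw [nonnegInd_of_nonneg (hV t), nonnegInd_of_nonneg hV', zero_add, frob_neg, frob_sub,
            hcompl t, sub_zero]
          exact_mod_cast neg_nonpos.2 (frob_nonneg (hL t) hV')
        · rw [nonnegInd_of_not hV']
          exact le_top
      stat_y := hy
      stat_z := hz
      feas₁ := by
        ext i; exact congrFun hres (Sum.inl i)
      feas₂ := fun t => by
        ext i j; exact congrFun hres (Sum.inr ⟨t, i, j⟩) }

/-- The transport problem `min ⟨[0; vec D], l⟩` over the transport plans has a solution. -/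
theorem exists_optimal_plan (hN : 0 < N) (hm : 0 < m)
    (ha : ∀ t, a t ∈ stdSimplex ℝ (Fin (mt t))) :
    ∃ l : UV m mt → ℝ, ((∀ r, 0 ≤ l (Sum.inr r)) ∧ (matB m mt)ᵀ *ᵥ l = -cost m a) ∧
      ∀ l' : UV m mt → ℝ, (∀ r, 0 ≤ l' (Sum.inr r)) → (matB m mt)ᵀ *ᵥ l' = -cost m a →
        rhs D ⬝ᵥ l ≤ rhs D ⬝ᵥ l' := by
  set S : Set (UV m mt → ℝ) :=
    {l | (∀ r, 0 ≤ l (Sum.inr r)) ∧ (matB m mt)ᵀ *ᵥ l = -cost m a} with hS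
  have hclosed : IsClosed S := by
    have : S = (⋂ r, {l | 0 ≤ l (Sum.inr r)}) ∩ {l | (matB m mt)ᵀ *ᵥ l = -cost m a} := by
      ext l
      simp [hS]
    rw [this]
    exact (isClosed_iInter fun r => isClosed_le continuous_const (continuous_apply _)).inter
      (isClosed_eq (by fun_prop) continuous_const)
  have hbdd : S ⊆ Set.Icc 0 1 := by
    rintro l ⟨hl0, hl⟩
    obtain ⟨lam, Lam, rfl⟩ := exists_vecUV l
    rw [matB_transpose_mulVec, cost] at hl
    have hL : NonnegEntries Lam := fun t i j => hl0 ⟨t, i, j⟩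
    have hy : ∀ t i, lam i = ∑ j, Lam t i j := fun t i => by
      have := congrFun hl (Sum.inl (t, i))
      simpa [vecYZ, Matrix.mulVec, dotProduct, sub_eq_zero] using this
    have hz : ∀ t j, ∑ i, Lam t i j = a t j := fun t j => by
      have := congrFun hl (Sum.inr ⟨t, j⟩)
      simpa [vecYZ, Matrix.mulVec, dotProduct] using this
    have hLa : ∀ t i j, Lam t i j ≤ a t j := fun t i j => by
      rw [← hz t j]
      exact Finset.single_le_sum (f := fun i => Lam t i j) (fun i _ => hL t i j) (Finset.mem_univ i)
    have t₀ : Fin N := ⟨0, hN⟩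
    constructor
    · rintro (i | r)
      · change 0 ≤ lam i
        rw [hy t₀ i]
        exact Finset.sum_nonneg fun j _ => hL t₀ i j
      · exact hl0 r
    · rintro (i | ⟨t, i, j⟩)
      · change lam i ≤ 1
        rw [hy t₀ i, ← (ha t₀).2]
        exact Finset.sum_le_sum fun j _ => hLa t₀ i j
      · change Lam t i j ≤ 1
        refine (hLa t i j).trans ?_
        rw [← (ha t).2]
        exact Finset.single_le_sum (f := a t) (fun j _ => (ha t).1 j) (Finset.mem_univ j)
  have hne : S.Nonempty := by
    refine ⟨vecUV (fun _ => (m : ℝ)⁻¹) fun t => Matrix.of fun _ j => (m : ℝ)⁻¹ * a t j, ?_, ?_⟩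
    · rintro ⟨t, i, j⟩
      exact mul_nonneg (by positivity) ((ha t).1 j)
    · have hm' : (m : ℝ) ≠ 0 := by exact_mod_cast hm.ne'
      rw [matB_transpose_mulVec, cost]
      ext (⟨t, i⟩ | ⟨t, j⟩)
      · simp [vecYZ, Matrix.mulVec, dotProduct, ← Finset.mul_sum, (ha t).2]
      · simp [vecYZ, Matrix.mulVec, dotProduct, hm']
  obtain ⟨l, hl, hmin⟩ := (isCompact_Icc.of_isClosed_subset hclosed hbdd).exists_isMinOn hne
    (f := fun l => rhs D ⬝ᵥ l) (by fun_prop)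
  exact ⟨l, hl, fun l' h1 h2 => hmin ⟨h1, h2⟩⟩

/-- Linear programming duality for the transport problem. The multipliers of an optimal plan give
a solution with `u = 0`, because the normalisation `λ ∈ Δ` follows from the other constraints. -/
theorem exists_system_solution (hN : 0 < N) (hm : 0 < m)
    (ha : ∀ t, a t ∈ stdSimplex ℝ (Fin (mt t))) :
    ∃ p : Blocks m mt, (∀ i, kktIneq D a p i ≤ 0) ∧ kktEq m mt p = kktRhs D a := by
  obtain ⟨l, ⟨hl0, hl⟩, hmin⟩ := exists_optimal_plan (D := D) hN hm ha
  obtain ⟨s, w, hs0, hsl, hsw⟩ := lp_multipliers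
    (G := -(LinearMap.funLeft ℝ ℝ (Sum.inr : VIdx m mt → UV m mt)))
    (H := Matrix.mulVecLin (matB m mt)ᵀ) (b := 0) (d := -cost m a)
    (g := -(dotProductBilin ℝ ℝ (rhs D))) l
    ⟨fun r => by simpa [LinearMap.funLeft] using hl0 r, hl⟩ fun l' h1 h2 => by
      have := hmin l' (fun r => by simpa [LinearMap.funLeft] using h1 r) h2
      simpa using this
  have hA : matA m mt *ᵥ Sum.elim (0 : Fin m → ℝ) s = Sum.elim (0 : Fin m → ℝ) s := by
    simp [matA, Matrix.fromBlocks_mulVec]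
  have hs : ∀ x : UV m mt → ℝ, Sum.elim (0 : Fin m → ℝ) s ⬝ᵥ x = s ⬝ᵥ (x ∘ Sum.inr) := fun x => by
    conv_lhs => rw [← Sum.elim_comp_inl_inr x, sumElim_dotProduct_sumElim]
    simp
  have hsw' : ∀ x : UV m mt → ℝ, rhs D ⬝ᵥ x = s ⬝ᵥ (x ∘ Sum.inr) - (matB m mt *ᵥ w) ⬝ᵥ x := by
    intro x
    have h1 : -(rhs D ⬝ᵥ x) = s ⬝ᵥ (-(x ∘ Sum.inr)) + w ⬝ᵥ ((matB m mt)ᵀ *ᵥ x) := hsw x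
    rw [dotProduct_neg, Matrix.dotProduct_mulVec, Matrix.vecMul_transpose] at h1
    linarith
  have hc : matA m mt *ᵥ Sum.elim (0 : Fin m → ℝ) s + matB m mt *ᵥ (-w) = rhs D := by
    refine dotProduct_eq _ _ fun x => ?_
    rw [add_dotProduct, hA, hs, hsw', Matrix.mulVec_neg, neg_dotProduct, sub_eq_add_neg]
  have hcompl : s ⬝ᵥ (l ∘ Sum.inr) = 0 := Finset.sum_eq_zero fun r _ => by
    have : s r * (0 - -(l (Sum.inr r))) = 0 := hsl r
    simpa using this
  refine ⟨(Sum.elim (0 : Fin m → ℝ) s, -w, l), ?_, ?_⟩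
  · rintro (r | r | i)
    · exact neg_nonpos.2 (hs0 r)
    · exact neg_nonpos.2 (hl0 r)
    · have h1 : cost m a ⬝ᵥ w = -((matB m mt *ᵥ w) ⬝ᵥ l) := by
        rw [← neg_neg (cost m a), ← hl, neg_dotProduct, dotProduct_comm, Matrix.dotProduct_mulVec,
          Matrix.vecMul_transpose]
      change (0 : ℝ) + cost m a ⬝ᵥ (-w) + rhs D ⬝ᵥ l ≤ 0
      rw [dotProduct_neg, h1, hsw', hcompl]
      simp
  · ext (r | r)
    · exact congrFun hc r
    · exact congrFun hl r

end System

/-! ### Norm bounds -/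

section Norms

variable {ι κ : Type*} [Fintype ι] [Fintype κ]

theorem exists_norm_mulVec_le (T : Matrix κ ι ℝ) :
    ∃ K : ℝ, 0 ≤ K ∧ ∀ x, ‖T *ᵥ x‖ ≤ K * ‖x‖ := by
  obtain ⟨K, hK0, hK⟩ := (LinearMap.toContinuousLinearMap T.mulVecLin).isBoundedLinearMap.bound
  exact ⟨K, hK0.le, hK⟩

theorem abs_dotProduct_le (x y : ι → ℝ) : |x ⬝ᵥ y| ≤ Fintype.card ι * (‖x‖ * ‖y‖) := by
  calc |x ⬝ᵥ y| ≤ ∑ i, |x i * y i| := Finset.abs_sum_le_sum_abs _ _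
    _ ≤ ∑ _i : ι, ‖x‖ * ‖y‖ := Finset.sum_le_sum fun i _ => by
        rw [abs_mul]
        exact mul_le_mul (norm_le_pi_norm x i) (norm_le_pi_norm y i) (abs_nonneg _) (norm_nonneg _)
    _ = _ := by rw [Finset.sum_const, Finset.card_univ, nsmul_eq_mul]

theorem norm_le_sqrt_of_dotProduct_le {x : ι → ℝ} {S : ℝ} (h : x ⬝ᵥ x ≤ S) : ‖x‖ ≤ Real.sqrt S :=
  (pi_norm_le_iff_of_nonneg (Real.sqrt_nonneg S)).2 fun i => by
    refine Real.abs_le_sqrt (le_trans ?_ h)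
    rw [sq]
    exact Finset.single_le_sum (f := fun i => x i * x i) (fun i _ => mul_self_nonneg (x i))
      (Finset.mem_univ i)

theorem exists_quadratic_le (T : Matrix ι ι ℝ) :
    ∃ K : ℝ, 0 ≤ K ∧ ∀ x, x ⬝ᵥ (T *ᵥ x) ≤ K * ‖x‖ ^ 2 := by
  obtain ⟨K, hK0, hK⟩ := exists_norm_mulVec_le T
  refine ⟨Fintype.card ι * K, by positivity, fun x => ?_⟩
  calc x ⬝ᵥ (T *ᵥ x) ≤ Fintype.card ι * (‖x‖ * ‖T *ᵥ x‖) :=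
        (le_abs_self _).trans (abs_dotProduct_le _ _)
    _ ≤ Fintype.card ι * (‖x‖ * (K * ‖x‖)) := by gcongr; exact hK x
    _ = _ := by ring

theorem exists_le_quadratic {T : Matrix ι ι ℝ} (hT : T.PosDef) :
    ∃ c : ℝ, 0 < c ∧ ∀ x, c * ‖x‖ ^ 2 ≤ x ⬝ᵥ (T *ᵥ x) := by
  have hpos : ∀ x : ι → ℝ, x ≠ 0 → 0 < x ⬝ᵥ (T *ᵥ x) := fun x hx => by
    simpa using hT.dotProduct_mulVec_pos hx
  obtain ⟨c, hc, hcs⟩ : ∃ c : ℝ, 0 < c ∧ ∀ x : ι → ℝ, ‖x‖ = 1 → c ≤ x ⬝ᵥ (T *ᵥ x) := by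
    rcases (Metric.sphere (0 : ι → ℝ) 1).eq_empty_or_nonempty with h | h
    · exact ⟨1, one_pos, fun x hx => absurd (mem_sphere_zero_iff_norm.2 hx) (by simp [h])⟩
    · obtain ⟨x, hx, hmin⟩ := (isCompact_sphere (0 : ι → ℝ) 1).exists_isMinOn h
        (f := fun x => x ⬝ᵥ (T *ᵥ x)) (by fun_prop)
      refine ⟨x ⬝ᵥ (T *ᵥ x), hpos x fun h0 => ?_, fun y hy => hmin (mem_sphere_zero_iff_norm.2 hy)⟩
      rw [mem_sphere_zero_iff_norm, h0, norm_zero] at hx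
      exact zero_ne_one hx
  refine ⟨c, hc, fun x => ?_⟩
  rcases eq_or_ne x 0 with rfl | hx
  · simp
  have hx' := norm_ne_zero_iff.2 hx
  have h1 := hcs (‖x‖⁻¹ • x) (by rw [norm_smul, norm_inv, norm_norm, inv_mul_cancel₀ hx'])
  rw [Matrix.mulVec_smul, dotProduct_smul, smul_dotProduct, smul_eq_mul, smul_eq_mul] at h1
  calc c * ‖x‖ ^ 2 ≤ (‖x‖⁻¹ * (‖x‖⁻¹ * (x ⬝ᵥ (T *ᵥ x)))) * ‖x‖ ^ 2 := by gcongr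
    _ = _ := by field_simp

end Norms

/-! ### The error bound along the iterates -/

section ErrorBound

variable {N m : ℕ} {mt : Fin N → ℕ}
variable {D : (t : Fin N) → Matrix (Fin m) (Fin (mt t)) ℝ} {a : (t : Fin N) → Fin (mt t) → ℝ}

/-- The multiplier `l + β (A x' + B w - [0; vec D])` for which the new block `[u; v]` satisfies its
inclusions in the KKT system exactly. -/
def predMult (D : (t : Fin N) → Matrix (Fin m) (Fin (mt t)) ℝ) (β : ℝ) (W W' : Point m mt) :
    UV m mt → ℝ :=
  W.mult + β • resid D W'.primal W.free

theorem resid_free_sub (W W' : Point m mt) : resid D W'.primal W.free =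
    resid D W'.primal W'.free - matB m mt *ᵥ (W'.free - W.free) := by
  rw [resid, resid, Matrix.mulVec_sub]; abel

theorem StepConditions.predMult_nonneg {β τ : ℝ} {W W' : Point m mt}
    (h : StepConditions D a β τ W W') (r : VIdx m mt) : 0 ≤ predMult D β W W' (Sum.inr r) := by
  classical
  set E : (t : Fin N) → Matrix (Fin m) (Fin (mt t)) ℝ := fun t =>
    Matrix.of fun i j => (Pi.single (Sum.inr r) 1 : UV m mt → ℝ) (Sum.inr ⟨t, i, j⟩) with hE
  have hV : NonnegEntries fun t => W'.V t + E t := fun t i j =>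
    add_nonneg (h.nonneg t i j) (by
      simp only [hE, Matrix.of_apply, Pi.single_apply]
      split_ifs
      exacts [zero_le_one, le_rfl])
  have h1 := h.primal W'.u _ hV
  have h2 : vecUV W'.u (fun t => W'.V t + E t) - W'.primal = vecUV 0 E := by
    ext (i | ⟨t, i, j⟩) <;> simp [vecUV, Point.primal]
  have h3 : vecUV (-0) E = (Pi.single (Sum.inr r) 1 : UV m mt → ℝ) := by
    ext (i | ⟨t, i, j⟩)
    · simp [vecUV]
    · rfl
  rw [h2, matA_mulVec, h3, sub_self, zero_add, dotProduct_single_one] at h1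
  exact h1

theorem StepConditions.maxCoord_add_le {β τ : ℝ} {W W' : Point m mt}
    (h : StepConditions D a β τ W W') :
    maxCoord W'.u + predMult D β W W' ⬝ᵥ (matA m mt *ᵥ W'.primal) ≤ 0 := by
  have h1 := h.primal 0 (fun _ => 0) fun t i j => le_rfl
  have h2 : vecUV 0 (fun _ => 0) - W'.primal = -W'.primal := by
    ext (i | ⟨t, i, j⟩) <;> simp [vecUV]
  rw [h2, maxCoord_zero, Matrix.mulVec_neg, dotProduct_neg] at h1
  rw [predMult]
  linarith

theorem StepConditions.dual_resid {β τ : ℝ} {W W' : Point m mt}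
    (h : StepConditions D a β τ W W') :
    cost m a + (matB m mt)ᵀ *ᵥ predMult D β W W' =
      -(β • (matC m mt *ᵥ (W'.free - W.free)) +
        β • ((matB m mt)ᵀ *ᵥ (matB m mt *ᵥ (W'.free - W.free)))) := by
  have h1 := h.free
  rw [predMult, resid_free_sub, smul_sub, ← add_sub_assoc, Matrix.mulVec_sub, ← add_sub_assoc,
    eq_neg_of_add_eq_zero_left h1, Matrix.mulVec_smul]
  abel

theorem StepConditions.mult_sub {β τ : ℝ} {W W' : Point m mt}
    (h : StepConditions D a β τ W W') :
    W'.mult - predMult D β W W' = ((τ - 1) * β) • resid D W'.primal W'.free +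
      β • (matB m mt *ᵥ (W'.free - W.free)) := by
  rw [h.mult, predMult, resid_free_sub W W', sub_mul, one_mul, sub_smul, smul_sub]
  abel

/-- The residuals of the KKT system at the point with the multiplier `predMult` are controlled by
the square root of the progress. -/
theorem exists_resid_bounds (hm : 0 < m) (mt : Fin N → ℕ) (β τ : ℝ) :
    ∃ K : ℝ, 0 ≤ K ∧ ∀ (D : (t : Fin N) → Matrix (Fin m) (Fin (mt t)) ℝ)
      (a : (t : Fin N) → Fin (mt t) → ℝ) (W W' : Point m mt), StepConditions D a β τ W W' →
      ∀ S, progress (W'.free - W.free) (resid D W'.primal W'.free) ≤ S →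
      ‖resid D W'.primal W'.free‖ ≤ K * Real.sqrt S ∧
      ‖cost m a + (matB m mt)ᵀ *ᵥ predMult D β W W'‖ ≤ K * Real.sqrt S ∧
      ‖W'.mult - predMult D β W W'‖ ≤ K * Real.sqrt S := by
  obtain ⟨K₁, hK₁0, hK₁⟩ := exists_norm_mulVec_le (matP m mt)ᵀ
  obtain ⟨K₂, hK₂0, hK₂⟩ := exists_norm_mulVec_le (matB m mt)ᵀ
  refine ⟨max 1 (max (|β| * ((m : ℝ)⁻¹ * (K₁ * Real.sqrt m)) + |β| * K₂) (|(τ - 1) * β| + |β|)),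
    zero_le_one.trans (le_max_left _ _), fun D a W W' h S hS => ?_⟩
  have hm' : (0 : ℝ) < m := by exact_mod_cast hm
  set Δ := W'.free - W.free
  set r := resid D W'.primal W'.free
  have p1 := matC_form_nonneg (mt := mt) hm Δ
  have p2 := real_dotProduct_self_nonneg (matB m mt *ᵥ Δ)
  have p3 := real_dotProduct_self_nonneg r
  rw [progress] at hS
  have hr : ‖r‖ ≤ Real.sqrt S := norm_le_sqrt_of_dotProduct_le (by linarith)
  have hB : ‖matB m mt *ᵥ Δ‖ ≤ Real.sqrt S := norm_le_sqrt_of_dotProduct_le (by linarith)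
  have hP : ‖matP m mt *ᵥ Δ‖ ≤ Real.sqrt m * Real.sqrt S := by
    rw [← Real.sqrt_mul hm'.le]
    refine norm_le_sqrt_of_dotProduct_le ?_
    have : (matP m mt *ᵥ Δ) ⬝ᵥ (matP m mt *ᵥ Δ) = m * (Δ ⬝ᵥ (matC m mt *ᵥ Δ)) := by
      rw [matC_form hm, mul_inv_cancel_left₀ hm'.ne']
    rw [this]
    exact mul_le_mul_of_nonneg_left (by linarith) hm'.le
  have hC : ‖matC m mt *ᵥ Δ‖ ≤ (m : ℝ)⁻¹ * (K₁ * Real.sqrt m) * Real.sqrt S := by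
    rw [matC_eq hm, Matrix.smul_mulVec, ← Matrix.mulVec_mulVec, norm_smul, Real.norm_eq_abs,
      abs_of_pos (inv_pos.2 hm'), mul_assoc, mul_assoc]
    gcongr
    exact (hK₁ _).trans (by gcongr)
  refine ⟨?_, ?_, ?_⟩
  · exact hr.trans (le_mul_of_one_le_left (Real.sqrt_nonneg _) (le_max_left _ _))
  · rw [h.dual_resid, norm_neg]
    calc _ ≤ |β| * ‖matC m mt *ᵥ Δ‖ + |β| * ‖(matB m mt)ᵀ *ᵥ (matB m mt *ᵥ Δ)‖ := by
          refine (norm_add_le _ _).trans_eq ?_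
          rw [norm_smul, norm_smul, Real.norm_eq_abs]
      _ ≤ |β| * ((m : ℝ)⁻¹ * (K₁ * Real.sqrt m) * Real.sqrt S) + |β| * (K₂ * Real.sqrt S) := by
          gcongr
          exact (hK₂ _).trans (by gcongr)
      _ = (|β| * ((m : ℝ)⁻¹ * (K₁ * Real.sqrt m)) + |β| * K₂) * Real.sqrt S := by ring
      _ ≤ _ := by
          gcongr
          exact (le_max_left _ _).trans (le_max_right _ _)
  · rw [h.mult_sub]
    calc _ ≤ |(τ - 1) * β| * ‖r‖ + |β| * ‖matB m mt *ᵥ Δ‖ := by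
          refine (norm_add_le _ _).trans_eq ?_
          rw [norm_smul, norm_smul, Real.norm_eq_abs, Real.norm_eq_abs]
      _ ≤ |(τ - 1) * β| * Real.sqrt S + |β| * Real.sqrt S := by gcongr
      _ = (|(τ - 1) * β| + |β|) * Real.sqrt S := by ring
      _ ≤ _ := by
          gcongr
          exact (le_max_right _ _).trans (le_max_right _ _)

/-- The error bound: as long as the iterates stay in a bounded set, the squared distance to the
KKT points is at most a multiple of the progress. -/
theorem exists_error_bound (hN : 0 < N) (hm : 0 < m)
    (ha : ∀ t, a t ∈ stdSimplex ℝ (Fin (mt t))) (β τ R : ℝ) (hR : 0 ≤ R) :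
    ∃ K : ℝ, 0 ≤ K ∧ ∀ W W' : Point m mt, StepConditions D a β τ W W' →
      ‖W'.free‖ ≤ R → ‖W'.mult‖ ≤ R →
      progress (W'.free - W.free) (resid D W'.primal W'.free) ≤ R →
      ∃ Ws : Point m mt, IsKKT D a Ws ∧
        sqDistM β τ W' Ws ≤ K * progress (W'.free - W.free) (resid D W'.primal W'.free) := by
  obtain ⟨K₁, hK₁0, hK₁⟩ := exists_resid_bounds (N := N) hm mt β τ
  obtain ⟨K₂, hK₂0, hK₂⟩ := hoffman (kktIneq D a) (kktEq m mt) 0 (kktRhs D a)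
    (exists_system_solution hN hm ha)
  obtain ⟨K₃, hK₃0, hK₃⟩ := exists_quadratic_le (matM m mt β τ)
  -- a bound for `predMult`, and for the violation of the linear system per unit of `√progress`
  set L := R + K₁ * Real.sqrt R with hL
  have hL0 : 0 ≤ L := by positivity
  set K₄ := K₁ + (Fintype.card (UV m mt) * (L * K₁) +
    Fintype.card (YIdx N m ⊕ ZIdx mt) * (K₁ * R)) with hK₄
  have hK₄1 : K₁ ≤ K₄ := le_add_of_nonneg_right (by positivity)
  refine ⟨K₃ * (K₂ * K₄ + K₁) ^ 2, by positivity, fun W W' h hw hl hSR => ?_⟩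
  set S := progress (W'.free - W.free) (resid D W'.primal W'.free) with hS
  have hS0 : 0 ≤ S := progress_nonneg hm _ _
  obtain ⟨b1, b2, b3⟩ := hK₁ D a W W' h S le_rfl
  set l := predMult D β W W' with hldef
  have hlL : ‖l‖ ≤ L := by
    have : l = W'.mult - (W'.mult - l) := by abel
    rw [this]
    refine (norm_sub_le _ _).trans (add_le_add hl (b3.trans ?_))
    gcongr
  have hε0 : 0 ≤ K₄ * Real.sqrt S := by positivity
  obtain ⟨p, ⟨hpG, hpH⟩, hp⟩ := hK₂ (W'.primal, W'.free, l) (K₄ * Real.sqrt S) hε0 (by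
    rintro (r | r | i)
    · exact (neg_nonpos.2 (h.nonneg r.1 r.2.1 r.2.2)).trans (by simpa using hε0)
    · exact (neg_nonpos.2 (h.predMult_nonneg r)).trans (by simpa using hε0)
    · have h1 := le_maxCoord W'.u i
      have h2 := h.maxCoord_add_le
      have h3 : l ⬝ᵥ resid D W'.primal W'.free = l ⬝ᵥ (matA m mt *ᵥ W'.primal) +
          (l ⬝ᵥ (matB m mt *ᵥ W'.free) - rhs D ⬝ᵥ l) := by
        rw [resid, dotProduct_sub, dotProduct_add, dotProduct_comm l (rhs D)]
        ring
      have h4 : (cost m a + (matB m mt)ᵀ *ᵥ l) ⬝ᵥ W'.free =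
          cost m a ⬝ᵥ W'.free + l ⬝ᵥ (matB m mt *ᵥ W'.free) := by
        rw [add_dotProduct, Matrix.mulVec_transpose, ← Matrix.dotProduct_mulVec]
      have h5 := (abs_le.1 (abs_dotProduct_le l (resid D W'.primal W'.free))).1
      have h6 := (abs_le.1 (abs_dotProduct_le (cost m a + (matB m mt)ᵀ *ᵥ l) W'.free)).2
      have h7 : Fintype.card (UV m mt) * (‖l‖ * ‖resid D W'.primal W'.free‖) ≤
          Fintype.card (UV m mt) * (L * (K₁ * Real.sqrt S)) := by gcongr
      have h8 : Fintype.card (YIdx N m ⊕ ZIdx mt) *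
          (‖cost m a + (matB m mt)ᵀ *ᵥ l‖ * ‖W'.free‖) ≤
          Fintype.card (YIdx N m ⊕ ZIdx mt) * (K₁ * Real.sqrt S * R) := by gcongr
      have h9 : 0 ≤ K₁ * Real.sqrt S := by positivity
      change W'.u i + cost m a ⬝ᵥ W'.free + rhs D ⬝ᵥ l ≤ 0 + K₄ * Real.sqrt S
      rw [hK₄]
      linarith) (by
    have hle : K₁ * Real.sqrt S ≤ K₄ * Real.sqrt S := by gcongr
    rintro (r | r)
    · exact (norm_le_pi_norm (resid D W'.primal W'.free) r).trans (b1.trans hle)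
    · refine le_trans ?_ ((norm_le_pi_norm (cost m a + (matB m mt)ᵀ *ᵥ l) r).trans (b2.trans hle))
      rw [Real.norm_eq_abs]
      change |((matB m mt)ᵀ *ᵥ l) r - -cost m a r| ≤ |cost m a r + ((matB m mt)ᵀ *ᵥ l) r|
      rw [sub_neg_eq_add, add_comm])
  obtain ⟨Ws, hWs, e1, e2, e3⟩ := exists_isKKT_of_system hN hm ha p hpG hpH
  refine ⟨Ws, hWs, ?_⟩
  have q1 : ‖W'.primal - p.1‖ ≤ K₂ * (K₄ * Real.sqrt S) := (norm_fst_le _).trans hp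
  have q2 : ‖W'.free - p.2.1‖ ≤ K₂ * (K₄ * Real.sqrt S) :=
    ((norm_fst_le _).trans (norm_snd_le _)).trans hp
  have q3 : ‖l - p.2.2‖ ≤ K₂ * (K₄ * Real.sqrt S) :=
    ((norm_snd_le _).trans (norm_snd_le _)).trans hp
  have q4 : ‖W'.mult - p.2.2‖ ≤ K₂ * (K₄ * Real.sqrt S) + K₁ * Real.sqrt S := by
    have : W'.mult - p.2.2 = (l - p.2.2) + (W'.mult - l) := by abel
    rw [this]
    exact (norm_add_le _ _).trans (add_le_add q3 b3)
  have q5 : 0 ≤ K₁ * Real.sqrt S := by positivity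
  have hvec : ‖W'.vec - Ws.vec‖ ≤ (K₂ * K₄ + K₁) * Real.sqrt S := by
    rw [vec_sub, e1, e2, e3]
    refine (pi_norm_le_iff_of_nonneg (by positivity)).2 ?_
    rintro (i | i | i)
    · exact (norm_le_pi_norm (W'.primal - p.1) i).trans (by linarith)
    · exact (norm_le_pi_norm (W'.free - p.2.1) i).trans (by linarith)
    · exact (norm_le_pi_norm (W'.mult - p.2.2) i).trans (by linarith)
  calc sqDistM β τ W' Ws ≤ K₃ * ‖W'.vec - Ws.vec‖ ^ 2 := hK₃ _
    _ ≤ K₃ * ((K₂ * K₄ + K₁) * Real.sqrt S) ^ 2 := by gcongr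
    _ = K₃ * (K₂ * K₄ + K₁) ^ 2 * S := by rw [mul_pow, Real.sq_sqrt hS0]; ring

end ErrorBound

/-! ### Linear convergence -/

section Convergence

variable {N m : ℕ} {mt : Fin N → ℕ}
variable {D : (t : Fin N) → Matrix (Fin m) (Fin (mt t)) ℝ} {a : (t : Fin N) → Fin (mt t) → ℝ}

theorem distM_sq_le {β τ : ℝ} (hM : (matM m mt β τ).PosDef) {S : Set (Point m mt)}
    {W Ws : Point m mt} (hWs : Ws ∈ S) : distM (matM m mt β τ) W S ^ 2 ≤ sqDistM β τ W Ws := by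
  have h0 : ∀ b ∈ (fun W' : Point m mt => wnorm (matM m mt β τ) (W.vec - W'.vec)) '' S, 0 ≤ b := by
    rintro _ ⟨W', -, rfl⟩
    exact Real.sqrt_nonneg _
  have h1 : distM (matM m mt β τ) W S ≤ wnorm (matM m mt β τ) (W.vec - Ws.vec) :=
    csInf_le ⟨0, h0⟩ ⟨Ws, hWs, rfl⟩
  refine (pow_le_pow_left₀ (Real.sInf_nonneg h0) h1 2).trans_eq (Real.sq_sqrt ?_)
  simpa using hM.posSemidef.dotProduct_mulVec_nonneg (W.vec - Ws.vec)

theorem le_distM_sq {β τ : ℝ} {S : Set (Point m mt)} (hS : S.Nonempty) {W : Point m mt} {c : ℝ}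
    (h : ∀ Ws ∈ S, c ≤ sqDistM β τ W Ws) : c ≤ distM (matM m mt β τ) W S ^ 2 := by
  rcases le_or_gt c 0 with hc | hc
  · exact hc.trans (sq_nonneg _)
  have h1 : Real.sqrt c ≤ distM (matM m mt β τ) W S := by
    refine le_csInf (hS.image _) ?_
    rintro _ ⟨Ws, hWs, rfl⟩
    exact Real.sqrt_le_sqrt (h Ws hWs)
  calc c = Real.sqrt c ^ 2 := (Real.sq_sqrt hc.le).symm
    _ ≤ _ := pow_le_pow_left₀ (Real.sqrt_nonneg c) h1 2

theorem kktSet_nonempty (hN : 0 < N) (hm : 0 < m)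
    (ha : ∀ t, a t ∈ stdSimplex ℝ (Fin (mt t))) : (kktSet D a).Nonempty := by
  obtain ⟨p, hG, hH⟩ := exists_system_solution (D := D) hN hm ha
  obtain ⟨W, hW, -⟩ := exists_isKKT_of_system hN hm ha p hG hH
  exact ⟨W, hW⟩

/-- Boundedness of the iterates and of the progress, from the monotonicity of the energy. -/
theorem exists_iterate_bound (hm : 0 < m) {β τ : ℝ} (hβ : 0 < β) (hτ₀ : 0 < τ)
    (hτ₁ : τ < (1 + Real.sqrt 5) / 2) (hM : (matM m mt β τ).PosDef) {W : ℕ → Point m mt}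
    (hW : ∀ k, StepConditions D a β τ (W k) (W (k + 1))) {Ws : Point m mt} (hs : IsKKT D a Ws) :
    ∃ R : ℝ, 0 ≤ R ∧ ∀ k, 1 ≤ k → ‖(W (k + 1)).free‖ ≤ R ∧ ‖(W (k + 1)).mult‖ ≤ R ∧
      progress ((W (k + 1)).free - (W k).free) (resid D (W (k + 1)).primal (W (k + 1)).free)
        ≤ R := by
  have hγ := mul_pos (decreaseConst_pos τ hτ₀ hτ₁) hβ
  set Φ : ℕ → ℝ := fun k => sqDistM β τ (W (k + 1)) Ws + β *
    (((W (k + 1)).free - (W k).free) ⬝ᵥ (matC m mt *ᵥ ((W (k + 1)).free - (W k).free))) with hΦ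
  have hdec : ∀ k, Φ (k + 1) + decreaseConst τ * β * progress ((W (k + 2)).free - (W (k + 1)).free)
      (resid D (W (k + 2)).primal (W (k + 2)).free) ≤ Φ k := fun k =>
    energy_decrease hm hβ hτ₀ hτ₁ (hW k) (hW (k + 1)) hs
  have hanti : Antitone Φ := antitone_nat_of_succ_le fun k => by
    have := mul_nonneg hγ.le (progress_nonneg (mt := mt) hm ((W (k + 2)).free - (W (k + 1)).free)
      (resid D (W (k + 2)).primal (W (k + 2)).free))
    linarith [hdec k]
  obtain ⟨c, hc, hcM⟩ := exists_le_quadratic hM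
  have hΦc : ∀ k, c * ‖(W (k + 1)).vec - Ws.vec‖ ^ 2 ≤ Φ k := fun k =>
    (hcM _).trans (le_add_of_nonneg_right (mul_nonneg hβ.le (matC_form_nonneg hm _)))
  have hΦ0 : ∀ k, 0 ≤ Φ k := fun k => (by positivity : (0 : ℝ) ≤ _).trans (hΦc k)
  have hdist : ∀ k, ‖(W (k + 1)).vec - Ws.vec‖ ≤ Real.sqrt (Φ 0 / c) := fun k =>
    Real.le_sqrt_of_sq_le (by
      rw [le_div_iff₀ hc, mul_comm]
      exact (hΦc k).trans (hanti (Nat.zero_le k)))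
  have hvec : ∀ k, ‖(W (k + 1)).vec‖ ≤ Real.sqrt (Φ 0 / c) + ‖Ws.vec‖ := fun k => by
    have : (W (k + 1)).vec = ((W (k + 1)).vec - Ws.vec) + Ws.vec := by abel
    rw [this]
    exact (norm_add_le _ _).trans (by gcongr; exact hdist k)
  refine ⟨max (Real.sqrt (Φ 0 / c) + ‖Ws.vec‖) (Φ 0 / (decreaseConst τ * β)),
    le_max_of_le_left (by positivity), fun k hk => ⟨?_, ?_, ?_⟩⟩
  · refine le_trans ((pi_norm_le_iff_of_nonneg (norm_nonneg _)).2 fun i => ?_)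
      ((hvec k).trans (le_max_left _ _))
    exact norm_le_pi_norm (W (k + 1)).vec (Sum.inr (Sum.inl i))
  · refine le_trans ((pi_norm_le_iff_of_nonneg (norm_nonneg _)).2 fun i => ?_)
      ((hvec k).trans (le_max_left _ _))
    exact norm_le_pi_norm (W (k + 1)).vec (Sum.inr (Sum.inr i))
  · refine le_trans ?_ (le_max_right _ _)
    obtain ⟨j, rfl⟩ := Nat.exists_eq_add_of_le' hk
    rw [le_div_iff₀ hγ, mul_comm]
    linarith [hdec j, hΦ0 (j + 1), hanti (Nat.zero_le j)]

end Convergence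

end WassersteinBarycenter

end

open WassersteinBarycenter in
theorem theorem2 {N m : ℕ} (hN : 0 < N) (hm : 0 < m) (mt : Fin N → ℕ)
    (D : (t : Fin N) → Matrix (Fin m) (Fin (mt t)) ℝ)
    (a : (t : Fin N) → Fin (mt t) → ℝ) (ha : ∀ t, a t ∈ stdSimplex ℝ (Fin (mt t)))
    (β τ : ℝ) (hβ : 0 < β) (hτ₀ : 0 < τ) (hτ₁ : τ < (1 + Real.sqrt 5) / 2) :
    (kktSet D a).Nonempty ∧ (matM m mt β τ).PosDef ∧
    ∀ W : ℕ → Point m mt, IsSGSADMM D a β τ W →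
      ∃ ρ : ℝ, 0 < ρ ∧ ρ < 1 ∧ ∀ k : ℕ, 1 ≤ k →
        distM (matM m mt β τ) (W (k + 1)) (kktSet D a) ^ 2
            + β * wnorm (matC m mt)
                (vecYZ (W (k + 1)).y (W (k + 1)).z - vecYZ (W k).y (W k).z) ^ 2
          ≤ ρ * (distM (matM m mt β τ) (W k) (kktSet D a) ^ 2
            + β * wnorm (matC m mt)
                (vecYZ (W k).y (W k).z - vecYZ (W (k - 1)).y (W (k - 1)).z) ^ 2) := by
  have hmt : ∀ t, 0 < mt t := fun t => Nat.pos_of_ne_zero fun h => by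
    have h1 := (ha t).2
    rw [Finset.sum_eq_zero fun j _ => (h ▸ j).elim0] at h1
    exact zero_ne_one h1
  have hΩ : (kktSet D a).Nonempty := kktSet_nonempty hN hm ha
  have hM := matM_posDef hm hmt β τ hβ hτ₀ hτ₁
  refine ⟨hΩ, hM, fun W hW => ?_⟩
  have hstep : ∀ k, StepConditions D a β τ (W k) (W (k + 1)) := fun k => (hW.2 k).conditions hm hβ
  obtain ⟨Ws, hWs⟩ := hΩ
  obtain ⟨R, hR, hbound⟩ := exists_iterate_bound hm hβ hτ₀ hτ₁ hM hstep hWs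
  obtain ⟨K, hK0, hK⟩ := exists_error_bound (D := D) hN hm ha β τ R hR
  set γ := decreaseConst τ * β with hγdef
  have hγ : 0 < γ := mul_pos (decreaseConst_pos τ hτ₀ hτ₁) hβ
  have hKβ : 0 < K + β := by linarith
  -- the energy is at most `(K + β) S` after the iteration and decreases by at least `γ S`
  refine ⟨(K + β) / (K + β + γ), by positivity, (div_lt_one (by positivity)).2 (by linarith),
    fun k hk => ?_⟩
  obtain ⟨j, rfl⟩ := Nat.exists_eq_add_of_le' hk
  rw [wnorm_matC_sq hm, wnorm_matC_sq hm, Nat.add_sub_cancel]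
  change distM _ (W (j + 2)) _ ^ 2 + β * (((W (j + 2)).free - (W (j + 1)).free) ⬝ᵥ
      (matC m mt *ᵥ ((W (j + 2)).free - (W (j + 1)).free))) ≤
    _ * (distM _ (W (j + 1)) _ ^ 2 + β * (((W (j + 1)).free - (W j).free) ⬝ᵥ
      (matC m mt *ᵥ ((W (j + 1)).free - (W j).free))))
  obtain ⟨b1, b2, b3⟩ := hbound (j + 1) hk
  set S := progress ((W (j + 2)).free - (W (j + 1)).free)
    (resid D (W (j + 2)).primal (W (j + 2)).free) with hS
  set Q := ((W (j + 2)).free - (W (j + 1)).free) ⬝ᵥ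
      (matC m mt *ᵥ ((W (j + 2)).free - (W (j + 1)).free)) with hQ
  set Q' := ((W (j + 1)).free - (W j).free) ⬝ᵥ
      (matC m mt *ᵥ ((W (j + 1)).free - (W j).free)) with hQ'
  have hdec : distM (matM m mt β τ) (W (j + 2)) (kktSet D a) ^ 2 + β * Q + γ * S ≤
      distM (matM m mt β τ) (W (j + 1)) (kktSet D a) ^ 2 + β * Q' := by
    have : distM (matM m mt β τ) (W (j + 2)) (kktSet D a) ^ 2 + β * Q + γ * S - β * Q' ≤
        distM (matM m mt β τ) (W (j + 1)) (kktSet D a) ^ 2 :=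
      le_distM_sq ⟨Ws, hWs⟩ fun Ws' hWs' => by
        have h1 := energy_decrease hm hβ hτ₀ hτ₁ (hstep j) (hstep (j + 1)) hWs'
        have h2 := distM_sq_le hM (W := W (j + 2)) hWs'
        linarith
    linarith
  have herr : distM (matM m mt β τ) (W (j + 2)) (kktSet D a) ^ 2 + β * Q ≤ (K + β) * S := by
    obtain ⟨Ws', hWs', h1⟩ := hK _ _ (hstep (j + 1)) b1 b2 b3
    have h2 := distM_sq_le hM (W := W (j + 2)) (S := kktSet D a) hWs'
    have h3 : Q ≤ S := by
      have h4 := real_dotProduct_self_nonneg (matB m mt *ᵥ ((W (j + 2)).free - (W (j + 1)).free))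
      have h5 := real_dotProduct_self_nonneg (resid D (W (j + 2)).primal (W (j + 2)).free)
      rw [hS, progress]
      linarith
    have h4 := mul_le_mul_of_nonneg_left h3 hβ.le
    linarith
  rw [div_mul_eq_mul_div, le_div_iff₀ (by positivity)]
  linarith [mul_le_mul_of_nonneg_left hdec hKβ.le, mul_le_mul_of_nonneg_left herr hγ.le]
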